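/- Let $G$ be a Lie group with a bi-invariant Riemannian metric, and let $B$ be the corresponding $\operatorname{Ad}(G)$-invariant inner product on its Lie algebra $\mathfrak g=T_eG$. Let $H\subset K\subset G$ be closed connected subgroups with Lie algebras $\mathfrak h\subset\mathfrak k\subset\mathfrak g$, and suppose that the centre $\mathfrak z(\mathfrak h)$ of $\mathfrak h$ is non-trivial. Let $\mathfrak m_1$ be the $B$-orthogonal complement of $\mathfrak k$ in $\mathfrak g$ and $\mathfrak m_2$ the $B$-orthogonal complement of $\mathfrak h$ in $\mathfrak k$, and let $\mathfrak m=\mathfrak m_1\oplus\mathfrak m_2$. Via the differentials at the identity of the canonical projections we identify $T_o(G/K)\cong\mathfrak m_1$, $T_o(K/H)\cong\mathfrak m_2$ and $T_o(G/H)\cong\mathfrak m$, where $o$ denotes the base point (here, $G/H$ carries the smooth structure for which the projection $G\to G/H$ is a submersion). Let $\lambda>0$, let $g_\lambda$ be the $G$-invariant Riemannian metric on $G/H$ which is given at $o$ by the inner product $B|_{\mathfrak m_1}+\lambda B|_{\mathfrak m_2}$ on $\mathfrak m$, and let $\nabla$ be its Levi-Civita connection. For $W\in\mathfrak z(\mathfrak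 h)$ let $I^W$ be the $G$-invariant $(1,1)$-tensor on $G/H$ with $I^W_o=\operatorname{ad}(W)|_{\mathfrak m_1}+\frac1\lambda\operatorname{ad}(W)|_{\mathfrak m_2}$. Let $k\in\mathbb R$, $X_1\in\mathfrak m_1$ and $X_2\in\mathfrak m_2$. Then the curve $x:\mathbb R\to G/H$, $$x(t)=\exp t\,(X_1+\lambda X_2+kW)\,\exp t(1-\lambda)\Bigl(X_2+\frac k\lambda W\Bigr)\cdot o,$$ is the motion of a charged particle under the electromagnetic field $kI^W$ with $x(0)=o$ and $\dot x(0)=X_1+X_2$: it satisfies $$\nabla_{\dot x}\dot x=kI^W(\dot x)$$ for all $t\in\mathbb R$ together with these initial conditions, and every twice continuously differentiable solution of this equation with the same initial conditions, on an open interval containing $0$, coincides with $x$ on that interval. -/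

import Mathlib

open Set Manifold Bundle
open scoped ContDiff Topology

noncomputable section

/-! ### Lie groups: exponential map, Lie algebras of subgroups, bi-invariant metrics -/

section LieGroups

variable {E : Type*} [NormedAddCommGroup E] [NormedSpace ℝ E]
  {G : Type*} [TopologicalSpace G] [ChartedSpace E G] [Group G] [LieGroup 𝓘(ℝ, E) ∞ G]

theorem lieGroup_minSmoothness : LieGroup 𝓘(ℝ, E) (minSmoothness ℝ 3) G := by
  rw [minSmoothness_of_isRCLikeNormedField]
  infer_instance

variable [FiniteDimensional ℝ E]

/-- Left-invariant vector fields are complete: there is an integral curve through the identity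
which is defined for all times. -/
theorem exists_integralCurve_mulInvariantVectorField [T2Space G] (X : GroupLieAlgebra 𝓘(ℝ, E) G) :
    ∃ γ : ℝ → G, γ 0 = 1 ∧ IsMIntegralCurve (I := 𝓘(ℝ, E)) γ (mulInvariantVectorField X) := by
  have : LieGroup 𝓘(ℝ, E) (minSmoothness ℝ 3) G := lieGroup_minSmoothness
  have : IsManifold 𝓘(ℝ, E) 1 G := inferInstance
  have : CompleteSpace E := FiniteDimensional.complete ℝ E
  have hsm : ContMDiff 𝓘(ℝ, E) 𝓘(ℝ, E).tangent 1
      (fun g : G => (⟨g, mulInvariantVectorField X g⟩ : TangentBundle 𝓘(ℝ, E) G)) :=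
    (contMDiff_mulInvariantVectorField X).of_le (by
      rw [minSmoothness_of_isRCLikeNormedField]; norm_num)
  obtain ⟨γ, h0, hγ⟩ := exists_isMIntegralCurveAt_of_contMDiffAt_boundaryless
    (I := 𝓘(ℝ, E)) (0 : ℝ) (hsm 1)
  obtain ⟨ε, hε, hγ⟩ := isMIntegralCurveAt_iff'.1 hγ
  refine exists_isMIntegralCurve_of_isMIntegralCurveOn hsm hε (fun g => ?_) 1
  refine ⟨fun t => g * γ t, by simp [h0], ?_⟩
  intro t ht
  rw [Real.ball_eq_Ioo, zero_sub, zero_add] at hγ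
  have hL : MDifferentiableAt 𝓘(ℝ, E) 𝓘(ℝ, E) (fun y : G => g * y) (γ t) :=
    (contMDiff_mul_left (I := 𝓘(ℝ, E)) (n := 1) (a := g)).mdifferentiableAt one_ne_zero
  have hL' : MDifferentiableAt 𝓘(ℝ, E) 𝓘(ℝ, E) (fun y : G => γ t * y) 1 :=
    (contMDiff_mul_left (I := 𝓘(ℝ, E)) (n := 1) (a := γ t)).mdifferentiableAt one_ne_zero
  have hfun : (fun y : G => g * γ t * y) = (fun y => g * y) ∘ (fun y => γ t * y) := by
    ext y; simp [mul_assoc]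
  have key : ∀ q : G, γ t * 1 = q → MDifferentiableAt 𝓘(ℝ, E) 𝓘(ℝ, E) (fun y : G => g * y) q →
      (mfderiv 𝓘(ℝ, E) 𝓘(ℝ, E) (fun y : G => g * γ t * y) 1 : E →L[ℝ] E) =
      (mfderiv 𝓘(ℝ, E) 𝓘(ℝ, E) (fun y : G => g * y) q : E →L[ℝ] E).comp
        (mfderiv 𝓘(ℝ, E) 𝓘(ℝ, E) (fun y : G => γ t * y) 1 : E →L[ℝ] E) := by
    intro q hq hd
    subst hq
    rw [hfun]
    exact mfderiv_comp (I' := 𝓘(ℝ, E)) (1 : G) hd hL'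
  have key' : (mulInvariantVectorField X (g * γ t) : E) =
      (mfderiv 𝓘(ℝ, E) 𝓘(ℝ, E) (fun y : G => g * y) (γ t) : E →L[ℝ] E)
        (mulInvariantVectorField X (γ t) : E) :=
    congrArg (fun A : E →L[ℝ] E => A X) (key (γ t) (mul_one _) hL)
  have hcomp := hL.hasMFDerivAt.comp_hasMFDerivWithinAt t (hγ t ht)
  have hlin : ((mfderiv 𝓘(ℝ, E) 𝓘(ℝ, E) (fun y : G => g * y) (γ t) : E →L[ℝ] E).comp
      ((1 : ℝ →L[ℝ] ℝ).smulRight (mulInvariantVectorField X (γ t) : E))) =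
      (1 : ℝ →L[ℝ] ℝ).smulRight (mulInvariantVectorField X (g * γ t) : E) := by
    rw [key']
    ext
    simp
  exact hlin ▸ hcomp

/-- The exponential map of a Lie group: `lieExp X` is the value at time `1` of the integral curve
starting at the identity of the left-invariant vector field determined by `X`. -/
def lieExp [T2Space G] (X : GroupLieAlgebra 𝓘(ℝ, E) G) : G :=
  (exists_integralCurve_mulInvariantVectorField X).choose 1

/-- The Lie algebra of a closed subgroup `K`, as a subspace of the Lie algebra of `G`: it consists
of the `X` with `exp (t X) ∈ K` for all `t`. For a closed subgroup these vectors form a subspace;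
taking the span does not add anything and avoids using this fact. -/
def subgroupLieAlgebra [T2Space G] (K : Subgroup G) : Submodule ℝ (GroupLieAlgebra 𝓘(ℝ, E) G) :=
  Submodule.span ℝ {X | ∀ t : ℝ, lieExp (t • X) ∈ K}

/-- The centre of (the Lie algebra on) a subspace `𝔥` of the Lie algebra of `G`. -/
def lieCentre (𝔥 : Submodule ℝ (GroupLieAlgebra 𝓘(ℝ, E) G)) :
    Submodule ℝ (GroupLieAlgebra 𝓘(ℝ, E) G) where
  carrier := {W | W ∈ 𝔥 ∧ ∀ Z ∈ 𝔥, ⁅W, Z⁆ = 0}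
  add_mem' := by
    have : LieGroup 𝓘(ℝ, E) (minSmoothness ℝ 3) G := lieGroup_minSmoothness
    rintro a b ⟨ha, ha'⟩ ⟨hb, hb'⟩
    exact ⟨𝔥.add_mem ha hb, fun Z hZ => by rw [add_lie, ha' Z hZ, hb' Z hZ, add_zero]⟩
  zero_mem' := ⟨𝔥.zero_mem, fun Z _ => by
    have : LieGroup 𝓘(ℝ, E) (minSmoothness ℝ 3) G := lieGroup_minSmoothness
    exact zero_lie Z⟩
  smul_mem' := by
    have : LieGroup 𝓘(ℝ, E) (minSmoothness ℝ 3) G := lieGroup_minSmoothness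
    rintro c a ⟨ha, ha'⟩
    exact ⟨𝔥.smul_mem c ha, fun Z hZ => by rw [smul_lie, ha' Z hZ, smul_zero]⟩

/-- The orthogonal complement of a subspace with respect to a bilinear form. -/
def orthComplement {V : Type*} [AddCommGroup V] [Module ℝ V] [TopologicalSpace V]
    (B : V →L[ℝ] V →L[ℝ] ℝ) (S : Submodule ℝ V) : Submodule ℝ V where
  carrier := {X | ∀ Z ∈ S, B Z X = 0}
  add_mem' := by
    intro a b ha hb Z hZ
    rw [map_add, ha Z hZ, hb Z hZ, add_zero]
  zero_mem' := fun Z _ => map_zero _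
  smul_mem' := by
    intro c a ha Z hZ
    rw [map_smul, ha Z hZ, smul_zero]

/-- A Riemannian metric on a Lie group is bi-invariant if all left translations and all right
translations are isometries. -/
def IsBiInvariant
    (b : ContMDiffRiemannianMetric 𝓘(ℝ, E) ∞ E (fun x : G => TangentSpace 𝓘(ℝ, E) x)) : Prop :=
  (∀ (p x : G) (u v : TangentSpace 𝓘(ℝ, E) x),
    b.inner (p * x) (mfderiv 𝓘(ℝ, E) 𝓘(ℝ, E) (fun y => p * y) x u)
      (mfderiv 𝓘(ℝ, E) 𝓘(ℝ, E) (fun y => p * y) x v) = b.inner x u v) ∧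
  (∀ (p x : G) (u v : TangentSpace 𝓘(ℝ, E) x),
    b.inner (x * p) (mfderiv 𝓘(ℝ, E) 𝓘(ℝ, E) (fun y => y * p) x u)
      (mfderiv 𝓘(ℝ, E) 𝓘(ℝ, E) (fun y => y * p) x v) = b.inner x u v)

end LieGroups

/-! ### Levi-Civita connection and motion of a charged particle -/

section Riemannian

variable {F : Type*} [NormedAddCommGroup F] [NormedSpace ℝ F]
  {M : Type*} [TopologicalSpace M] [ChartedSpace F M]

/-- The velocity vector of a curve. -/
def velocity (c : ℝ → M) (t : ℝ) : TangentSpace 𝓘(ℝ, F) (c t) :=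
  mfderiv 𝓘(ℝ, ℝ) 𝓘(ℝ, F) c t (1 : ℝ)

variable [IsManifold 𝓘(ℝ, F) ∞ M]

/-- `nabla` is the Levi-Civita connection of the Riemannian metric `g`: it is torsion-free and
`v (g (Y, Z)) = g (∇_v Y, Z) + g (Y, ∇_v Z)`. Here `nabla Y x v` stands for `∇_v Y`, for a tangent
vector `v` at `x`. -/
def IsLeviCivita [FiniteDimensional ℝ F]
    (g : ContMDiffRiemannianMetric 𝓘(ℝ, F) ∞ F (fun x : M => TangentSpace 𝓘(ℝ, F) x))
    (nabla : CovariantDerivative 𝓘(ℝ, F) F (fun x : M => TangentSpace 𝓘(ℝ, F) x)) : Prop :=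
  haveI : CompleteSpace F := FiniteDimensional.complete ℝ F
  nabla.torsion = 0 ∧
  ∀ (x : M) (v : TangentSpace 𝓘(ℝ, F) x) (Y Z : ∀ y : M, TangentSpace 𝓘(ℝ, F) y),
    MDiffAt (T% Y) x → MDiffAt (T% Z) x →
    mfderiv 𝓘(ℝ, F) 𝓘(ℝ, ℝ) (fun y => g.inner y (Y y) (Z y)) x v =
      g.inner x (nabla Y x v) (Z x) + g.inner x (Y x) (nabla Z x v)

/-- The covariant derivative at time `t`, along the curve `c`, of the vector field `Y` along `c`.
In the coordinate frame `e₁, …, eₙ` of the chart at `c t`, a field `Y = ∑ Yⁱ eᵢ` along `c` has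
covariant derivative `∑ (dYⁱ/dt) eᵢ + Yⁱ ∇_{c'} eᵢ`. The first summand below is the first part of
this formula; `FiberBundle.extend F (Y t)` is the local vector field `∑ Yⁱ(t) eᵢ` with constant
coefficients, so that the second summand is the second part. -/
def covDerivAlong
    (nabla : CovariantDerivative 𝓘(ℝ, F) F (fun x : M => TangentSpace 𝓘(ℝ, F) x))
    (c : ℝ → M) (Y : ∀ t : ℝ, TangentSpace 𝓘(ℝ, F) (c t)) (t : ℝ) :
    TangentSpace 𝓘(ℝ, F) (c t) :=
  (trivializationAt F (fun x : M => TangentSpace 𝓘(ℝ, F) x) (c t)).symm (c t)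
      (deriv (fun s : ℝ =>
        (trivializationAt F (fun x : M => TangentSpace 𝓘(ℝ, F) x) (c t)
          (TotalSpace.mk' F (c s) (Y s))).2) t) +
    nabla (FiberBundle.extend F (Y t)) (c t) (velocity c t)

/-- The curve `c`, restricted to the open set `S` of times, is a motion of a charged particle under
the electromagnetic field `k J`: it is twice continuously differentiable and
`∇_{c'} c' = k J (c')`, at all times in `S`. -/
def IsChargedParticleMotionOn
    (nabla : CovariantDerivative 𝓘(ℝ, F) F (fun x : M => TangentSpace 𝓘(ℝ, F) x))
    (J : ∀ x : M, TangentSpace 𝓘(ℝ, F) x →L[ℝ] TangentSpace 𝓘(ℝ, F) x) (k : ℝ)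
    (c : ℝ → M) (S : Set ℝ) : Prop :=
  ContMDiffOn 𝓘(ℝ, ℝ) 𝓘(ℝ, F) 2 c S ∧
  ∀ t ∈ S, covDerivAlong nabla c (velocity c) t = k • J (c t) (velocity c t)

end Riemannian

/-! ### Invariant metrics and tensors on homogeneous spaces -/

section Homogeneous

variable {F : Type*} [NormedAddCommGroup F] [NormedSpace ℝ F]
  {G : Type*} [Group G] [TopologicalSpace G] {H : Subgroup G}
  [ChartedSpace F (G ⧸ H)] [IsManifold 𝓘(ℝ, F) ∞ (G ⧸ H)]

/-- The differential at `x` of the left translation `τ_p : G/H → G/H`. -/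
def translationDeriv (p : G) (x : G ⧸ H) :
    TangentSpace 𝓘(ℝ, F) x →L[ℝ] TangentSpace 𝓘(ℝ, F) (p • x) :=
  mfderiv 𝓘(ℝ, F) 𝓘(ℝ, F) (fun y : G ⧸ H => p • y) x

/-- A Riemannian metric on `G/H` is `G`-invariant if all left translations are isometries. -/
def IsInvariantMetric
    (g : ContMDiffRiemannianMetric 𝓘(ℝ, F) ∞ F (fun x : G ⧸ H => TangentSpace 𝓘(ℝ, F) x)) :
    Prop :=
  ∀ (p : G) (x : G ⧸ H) (u v : TangentSpace 𝓘(ℝ, F) x),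
    g.inner (p • x) (translationDeriv p x u) (translationDeriv p x v) = g.inner x u v

/-- A field of endomorphisms of the tangent spaces of `G/H` is `G`-invariant if it commutes with the
differentials of all left translations. -/
def IsInvariantTensor
    (J : ∀ x : G ⧸ H, TangentSpace 𝓘(ℝ, F) x →L[ℝ] TangentSpace 𝓘(ℝ, F) x) : Prop :=
  ∀ (p : G) (x : G ⧸ H) (v : TangentSpace 𝓘(ℝ, F) x),
    J (p • x) (translationDeriv p x v) = translationDeriv p x (J x v)

end Homogeneous

section BasePoint

variable {E : Type*} [NormedAddCommGroup E] [NormedSpace ℝ E]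
  {F : Type*} [NormedAddCommGroup F] [NormedSpace ℝ F]
  {G : Type*} [TopologicalSpace G] [ChartedSpace E G] [Group G]

/-- The differential at the identity of the projection `π : G → G/H`, from the Lie algebra of `G` to
the tangent space of `G/H` at the base point `o`. -/
def projDeriv (H : Subgroup G) [ChartedSpace F (G ⧸ H)] :
    GroupLieAlgebra 𝓘(ℝ, E) G →L[ℝ] TangentSpace 𝓘(ℝ, F) ((1 : G) : G ⧸ H) :=
  mfderiv 𝓘(ℝ, E) 𝓘(ℝ, F) (fun p : G => (p : G ⧸ H)) 1

end BasePoint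

end

/-!
The curve `x` is the projection of `p t = exp (t a) exp (t c)` with `a = X₁ + λ X₂ + k W` and
`c = (1 - λ) (X₂ + (k / λ) W)`, and both halves of the statement follow from the conservation of
momentum for the action of `G` on `G/H`.

Let `p` be a curve in `G`, `ξ = p⁻¹ p'` its body velocity, `y = p H` its projection, and let `S` be
the endomorphism of `𝔤` which is `1` on `𝔪₁`, `λ` on `𝔪₂` and `0` on `𝔥`, so that the metric `g_λ`
pulls back to `B (S ·, ·)` (`exists_metric_endomorphism`). The fundamental vector field `Z*` of
`Z ∈ 𝔤` is a Killing field, hence `d/dt g (y', Z*) = g (∇ y', Z*)`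
(`IsLeviCivita.hasDerivAt_inner_fundamentalField`). Since `B` is `Ad`-invariant,
`g (y', Z*) = B (Ad p (S ξ), Z)` and `g (I^W y', Z*) = B (Ad p [W, ξ], Z)`, while
`d/dt (Ad p W) = Ad p [ξ, W]`. Therefore the derivative of `B (Ad p (S ξ + k W), Z)` is
`g (∇ y' - k I^W y', Z*)` (`IsLeviCivita.hasDerivAt_momentum`). As the fields `Z*` span all tangent
spaces, `y` is a motion if and only if the momentum `Ad p (S ξ + k W)` is constant.

For the curve `x`, the element `c` commutes with `λ X₂ + k W` and `ad c` preserves `𝔪₁`, from which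
the momentum is found to be constantly equal to `a` (`momentum_lieExp_mul_lieExp`).

For uniqueness, let `σ` be a local section of the projection. A motion `y` with momentum `A` along
the lift `σ ∘ y` satisfies `S ξ = Ad (σ y)⁻¹ A - k W`, and `S ξ` determines `y'`. So `y` is an
integral curve of a `C¹` vector field (`momentumField`), which depends only on the initial
conditions, and local uniqueness is that of integral curves (`eventuallyEq_of_motion`). The times
at which two motions agree locally form an open set, which is also relatively closed
(`eq_and_modelDeriv_eq_of_frequently`) since `G/H` is a Hausdorff space.

What is needed about Lie groups is developed from the exponential map as it is defined here: the
adjoint representation, its derivative, the bracket, and the chain rule for body velocities.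
Tangent spaces are copies of the model space, and most of the computations are done there: see
`modelDeriv`, `lieAd`, `lieBr` and `leftProj`.
-/

noncomputable section

/-! ### The Lie derivative along a flow in a vector space -/

section LieDerivative

open VectorField Filter

/-- The Lie derivative of a vector field `V` along a local flow `Φ` with generator `K` is `[K, V]`.
Only `Φ (0, u) = u` is used, not the group law: the mixed second derivatives of `Φ` at time `0`
produce the derivative of `K`. -/
theorem hasDerivAt_flow_pullback_vectorSpace {F : Type*} [NormedAddCommGroup F] [NormedSpace ℝ F]
    {Φ : ℝ × F → F} {u₀ : F} (hΦ : ContDiffAt ℝ 2 Φ (0, u₀))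
    (hid : ∀ᶠ u in 𝓝 u₀, Φ (0, u) = u) {K V : F → F} (hV : DifferentiableAt ℝ V u₀)
    (hK : ∀ᶠ u in 𝓝 u₀, K u = fderiv ℝ Φ (0, u) (1, 0)) :
    HasDerivAt (fun s : ℝ => fderiv ℝ Φ (-s, Φ (s, u₀)) (0, V (Φ (s, u₀))))
      (lieBracket ℝ K V u₀) 0 := by
  have hΦ1 : DifferentiableAt ℝ Φ (0, u₀) := hΦ.differentiableAt (by norm_num)
  have hd : DifferentiableAt ℝ (fderiv ℝ Φ) (0, u₀) :=
    (hΦ.fderiv_right (m := 1) (by norm_num)).differentiableAt (by norm_num)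
  have hev : ∀ᶠ u in 𝓝 u₀, DifferentiableAt ℝ Φ (0, u) := by
    have h1 : ∀ᶠ q in 𝓝 ((0 : ℝ), u₀), DifferentiableAt ℝ Φ q :=
      (hΦ.eventually (by norm_num)).mono fun q hq => hq.differentiableAt (by norm_num)
    have h2 : ContinuousAt (fun u : F => ((0 : ℝ), u)) u₀ := by fun_prop
    exact h2.eventually h1
  have hid0 : Φ (0, u₀) = u₀ := hid.self_of_nhds
  have hinr : ∀ u : F, HasFDerivAt (fun u : F => ((0 : ℝ), u)) (ContinuousLinearMap.inr ℝ ℝ F) u :=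
    fun u => hasFDerivAt_prodMk_right 0 u
  have hpart : ∀ᶠ u in 𝓝 u₀, ∀ v, fderiv ℝ Φ (0, u) (0, v) = v := by
    filter_upwards [hid.eventually_nhds, hev] with u hu hdu v
    have h1 : HasFDerivAt (fun u : F => Φ (0, u)) ((fderiv ℝ Φ (0, u)).comp
      (ContinuousLinearMap.inr ℝ ℝ F)) u := hdu.hasFDerivAt.comp u (hinr u)
    have h2 : HasFDerivAt (fun u : F => Φ (0, u)) (ContinuousLinearMap.id ℝ F) u :=
      (hasFDerivAt_id u).congr_of_eventuallyEq hu
    have := congrArg (fun A : F →L[ℝ] F => A v) (h1.unique h2)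
    simpa using this
  have hmixed : ∀ w v, fderiv ℝ (fderiv ℝ Φ) (0, u₀) (0, w) (0, v) = 0 := by
    intro w v
    have h1 : HasFDerivAt (fun u : F => fderiv ℝ Φ (0, u) (0, v)) _ u₀ :=
      (hd.hasFDerivAt.comp u₀ (hinr u₀)).clm_apply (hasFDerivAt_const ((0 : ℝ), v) u₀)
    have h2 : HasFDerivAt (fun u : F => fderiv ℝ Φ (0, u) (0, v)) (0 : F →L[ℝ] F) u₀ :=
      (hasFDerivAt_const v u₀).congr_of_eventuallyEq (hpart.mono fun u hu => hu v)
    have := congrArg (fun A : F →L[ℝ] F => A w) (h1.unique h2)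
    simpa using this
  have hKd : ∀ v, fderiv ℝ K u₀ v = fderiv ℝ (fderiv ℝ Φ) (0, u₀) (0, v) (1, 0) := by
    intro v
    have h1 : HasFDerivAt (fun u : F => fderiv ℝ Φ (0, u) (1, 0)) _ u₀ :=
      (hd.hasFDerivAt.comp u₀ (hinr u₀)).clm_apply (hasFDerivAt_const ((1 : ℝ), (0 : F)) u₀)
    have h2 := (h1.congr_of_eventuallyEq hK).fderiv
    rw [h2]; simp
  have hsymm : ∀ a c, fderiv ℝ (fderiv ℝ Φ) (0, u₀) a c = fderiv ℝ (fderiv ℝ Φ) (0, u₀) c a :=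
    fun a c => (hΦ.isSymmSndFDerivAt (by simp)).eq a c
  have hcurve : HasDerivAt (fun s : ℝ => Φ (s, u₀)) (K u₀) 0 := by
    rw [hK.self_of_nhds]
    exact hΦ1.hasFDerivAt.comp_hasDerivAt (0 : ℝ)
      ((hasDerivAt_id (0 : ℝ)).prodMk (hasDerivAt_const (0 : ℝ) u₀))
  have hcurve2 : HasDerivAt (fun s : ℝ => (-s, Φ (s, u₀))) (-1, K u₀) 0 :=
    (hasDerivAt_neg (0 : ℝ)).prodMk hcurve
  have hA : HasDerivAt (fun s : ℝ => fderiv ℝ Φ (-s, Φ (s, u₀)))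
      (fderiv ℝ (fderiv ℝ Φ) (0, u₀) (-1, K u₀)) 0 := by
    refine HasFDerivAt.comp_hasDerivAt (0 : ℝ) ?_ hcurve2
    simpa [hid0] using hd.hasFDerivAt
  have hB : HasDerivAt (fun s : ℝ => ((0 : ℝ), V (Φ (s, u₀)))) (0, fderiv ℝ V u₀ (K u₀)) 0 := by
    refine (hasDerivAt_const _ _).prodMk ?_
    refine HasFDerivAt.comp_hasDerivAt (0 : ℝ) ?_ hcurve
    simpa [hid0] using hV.hasFDerivAt
  have := hA.clm_apply hB
  convert this using 1
  have e1 : ((-1 : ℝ), K u₀) = -((1 : ℝ), (0 : F)) + (0, K u₀) := by simp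
  simp only [neg_zero, hid0, lieBracket, hpart.self_of_nhds]
  rw [e1, map_add, map_neg, hKd, hsymm]
  simp only [add_apply, neg_apply, hmixed, add_zero]
  abel

end LieDerivative

/-! ### Differentials between model spaces; the Lie derivative along a flow -/

section ModelDerivative

variable {E H M E' H' M' E'' H'' M'' : Type*}
  [NormedAddCommGroup E] [NormedSpace ℝ E] [TopologicalSpace H] [TopologicalSpace M]
  [ChartedSpace H M]
  [NormedAddCommGroup E'] [NormedSpace ℝ E'] [TopologicalSpace H'] [TopologicalSpace M']
  [ChartedSpace H' M']
  [NormedAddCommGroup E''] [NormedSpace ℝ E''] [TopologicalSpace H''] [TopologicalSpace M'']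
  [ChartedSpace H'' M'']
  (I : ModelWithCorners ℝ E H) (I' : ModelWithCorners ℝ E' H') (I'' : ModelWithCorners ℝ E'' H'')

/-- The differential at `x` of a map between manifolds, regarded as a continuous linear map between
the model vector spaces. Each tangent space is a copy of the model space, so this is `mfderiv`
without the dependence of its type on the points `x` and `f x`. -/
def modelDeriv (f : M → M') (x : M) : E →L[ℝ] E' := mfderiv I I' f x

variable {I I' I''} {f : M → M'} {g : M' → M''} {x : M}

theorem modelDeriv_comp {y : M'} (hg : MDifferentiableAt I' I'' g y)
    (hf : MDifferentiableAt I I' f x) (hy : f x = y) :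
    modelDeriv I I'' (fun z => g (f z)) x = (modelDeriv I' I'' g y).comp (modelDeriv I I' f x) := by
  subst hy
  exact mfderiv_comp x hg hf

theorem modelDeriv_comp_apply {y : M'} (hg : MDifferentiableAt I' I'' g y)
    (hf : MDifferentiableAt I I' f x) (hy : f x = y) (v : E) :
    modelDeriv I I'' (fun z => g (f z)) x v = modelDeriv I' I'' g y (modelDeriv I I' f x v) := by
  rw [modelDeriv_comp hg hf hy]; rfl

theorem modelDeriv_congr {f' : M → M'} (h : f =ᶠ[𝓝 x] f') :
    modelDeriv I I' f x = modelDeriv I I' f' x := h.mfderiv_eq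

theorem modelDeriv_id : modelDeriv I I (fun z : M => z) x = ContinuousLinearMap.id ℝ E :=
  mfderiv_id

theorem modelDeriv_const {c : M'} : modelDeriv I I' (fun _ : M => c) x = 0 :=
  mfderiv_const

theorem modelDeriv_eq_fderiv {f : E → E'} {x : E} :
    modelDeriv 𝓘(ℝ, E) 𝓘(ℝ, E') f x = fderiv ℝ f x := mfderiv_eq_fderiv

theorem HasMFDerivAt.modelDeriv {f' : E →L[ℝ] E'} (h : HasMFDerivAt I I' f x f') :
    modelDeriv I I' f x = f' := h.mfderiv

end ModelDerivative

section LieDerivative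

open VectorField Filter

variable {F : Type*} [NormedAddCommGroup F] [NormedSpace ℝ F]
  {M : Type*} [TopologicalSpace M] [ChartedSpace F M] [IsManifold 𝓘(ℝ, F) ∞ M]

theorem modelDeriv_extChartAt_self (x : M) :
    modelDeriv 𝓘(ℝ, F) 𝓘(ℝ, F) (extChartAt 𝓘(ℝ, F) x) x = ContinuousLinearMap.id ℝ F :=
  mfderiv_extChartAt_self

omit [IsManifold 𝓘(ℝ, F) ∞ M] in
theorem contMDiffAt_extChartAt_symm {n : WithTop ℕ∞} [IsManifold 𝓘(ℝ, F) n M] (x : M) {u : F}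
    (hu : u ∈ (extChartAt 𝓘(ℝ, F) x).target) :
    ContMDiffAt 𝓘(ℝ, F) 𝓘(ℝ, F) n (extChartAt 𝓘(ℝ, F) x).symm u :=
  (contMDiffOn_extChartAt_symm x).contMDiffAt ((isOpen_extChartAt_target x).mem_nhds hu)

theorem modelDeriv_extChartAt_comp_symm (x : M) {u : F} (hu : u ∈ (extChartAt 𝓘(ℝ, F) x).target) :
    (modelDeriv 𝓘(ℝ, F) 𝓘(ℝ, F) (extChartAt 𝓘(ℝ, F) x) ((extChartAt 𝓘(ℝ, F) x).symm u)).comp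
      (modelDeriv 𝓘(ℝ, F) 𝓘(ℝ, F) (extChartAt 𝓘(ℝ, F) x).symm u) =
      ContinuousLinearMap.id ℝ F := by
  have := mfderiv_extChartAt_comp_mfderivWithin_extChartAt_symm (I := 𝓘(ℝ, F)) hu
  simp only [modelWithCornersSelf_coe, range_id, mfderivWithin_univ] at this
  exact this

theorem modelDeriv_extChartAt_symm_comp (x : M) {u : F} (hu : u ∈ (extChartAt 𝓘(ℝ, F) x).target) :
    (modelDeriv 𝓘(ℝ, F) 𝓘(ℝ, F) (extChartAt 𝓘(ℝ, F) x).symm u).comp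
      (modelDeriv 𝓘(ℝ, F) 𝓘(ℝ, F) (extChartAt 𝓘(ℝ, F) x) ((extChartAt 𝓘(ℝ, F) x).symm u)) =
      ContinuousLinearMap.id ℝ F := by
  have := mfderivWithin_extChartAt_symm_comp_mfderiv_extChartAt (I := 𝓘(ℝ, F)) hu
  simp only [modelWithCornersSelf_coe, range_id, mfderivWithin_univ] at this
  exact this

/-- The coordinate expression of a vector field in a chart. -/
theorem mpullbackWithin_extChartAt_symm_eq (x : M) {u : F}
    (hu : u ∈ (extChartAt 𝓘(ℝ, F) x).target) (V : ∀ y : M, TangentSpace 𝓘(ℝ, F) y) :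
    (mpullbackWithin 𝓘(ℝ, F) 𝓘(ℝ, F) (extChartAt 𝓘(ℝ, F) x).symm V (range 𝓘(ℝ, F)) u : F) =
      modelDeriv 𝓘(ℝ, F) 𝓘(ℝ, F) (extChartAt 𝓘(ℝ, F) x) ((extChartAt 𝓘(ℝ, F) x).symm u)
        (V ((extChartAt 𝓘(ℝ, F) x).symm u)) := by
  have h : (mfderivWithin 𝓘(ℝ, F) 𝓘(ℝ, F) (extChartAt 𝓘(ℝ, F) x).symm (range 𝓘(ℝ, F)) u).inverse
      = (modelDeriv 𝓘(ℝ, F) 𝓘(ℝ, F) (extChartAt 𝓘(ℝ, F) x)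
          ((extChartAt 𝓘(ℝ, F) x).symm u) : F →L[ℝ] F) := by
    simp only [modelWithCornersSelf_coe, range_id, mfderivWithin_univ]
    exact ContinuousLinearMap.inverse_eq (M := F) (M₂ := F) (modelDeriv_extChartAt_symm_comp x hu)
      (modelDeriv_extChartAt_comp_symm x hu)
  rw [mpullbackWithin_apply, h]
  rfl

/-- The Lie bracket of vector fields, computed in the chart at the point. -/
theorem mlieBracket_eq_lieBracket_chart (x : M) (K V : ∀ y : M, TangentSpace 𝓘(ℝ, F) y) :
    (mlieBracket 𝓘(ℝ, F) K V x : F) = lieBracket ℝ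
      (fun u : F => (mpullbackWithin 𝓘(ℝ, F) 𝓘(ℝ, F) (extChartAt 𝓘(ℝ, F) x).symm K
        (range 𝓘(ℝ, F)) u : F))
      (fun u : F => (mpullbackWithin 𝓘(ℝ, F) 𝓘(ℝ, F) (extChartAt 𝓘(ℝ, F) x).symm V
        (range 𝓘(ℝ, F)) u : F)) (extChartAt 𝓘(ℝ, F) x x) := by
  rw [← mlieBracketWithin_univ, mlieBracketWithin_apply, mfderiv_extChartAt_self]
  have h : (ContinuousLinearMap.id ℝ F).inverse = ContinuousLinearMap.id ℝ F :=
    ContinuousLinearMap.inverse_id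
  have h2 : (extChartAt 𝓘(ℝ, F) x).symm ⁻¹' univ ∩ range 𝓘(ℝ, F) = univ := by simp
  rw [h2]
  refine (congrArg (fun A : F →L[ℝ] F => A _) h).trans ?_
  exact congrFun lieBracketWithin_univ _

/-- The derivative at `s = 0` of the pullback of `V` along the flow `Φ` with generator `K` is
`[K, V]`. -/
theorem hasDerivAt_flow_pullback [CompleteSpace F] {Φ : ℝ × M → M}
    (hΦ : ContMDiff (𝓘(ℝ, ℝ).prod 𝓘(ℝ, F)) 𝓘(ℝ, F) 2 Φ) (hid : ∀ y, Φ (0, y) = y)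
    (hinv : ∀ s y, Φ (-s, Φ (s, y)) = y) {K V : ∀ y : M, TangentSpace 𝓘(ℝ, F) y} {x : M}
    (hK : ∀ y, (K y : F) = modelDeriv 𝓘(ℝ, ℝ) 𝓘(ℝ, F) (fun s : ℝ => Φ (s, y)) 0 1)
    (hV : MDiffAt (T% V) x) :
    HasDerivAt (fun s : ℝ => modelDeriv 𝓘(ℝ, F) 𝓘(ℝ, F) (fun y => Φ (-s, y)) (Φ (s, x))
      (V (Φ (s, x)))) (mlieBracket 𝓘(ℝ, F) K V x : F) 0 := by
  set ψ := extChartAt 𝓘(ℝ, F) x with hψ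
  set u₀ : F := ψ x with hu₀
  have hu₀t : u₀ ∈ ψ.target := mem_extChartAt_target x
  have hψx : ψ.symm u₀ = x := extChartAt_to_inv x
  have ht : ∀ᶠ u in 𝓝 u₀, u ∈ ψ.target := extChartAt_target_mem_nhds x
  let Φc : ℝ × F → F := fun q => ψ (Φ (q.1, ψ.symm q.2))
  let Kc : F → F := fun u => mpullbackWithin 𝓘(ℝ, F) 𝓘(ℝ, F) ψ.symm K (range 𝓘(ℝ, F)) u
  let Vc : F → F := fun u => mpullbackWithin 𝓘(ℝ, F) 𝓘(ℝ, F) ψ.symm V (range 𝓘(ℝ, F)) u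
  have hΦs2 : ∀ q : ℝ × F, q.2 ∈ ψ.target →
      ContMDiffAt (𝓘(ℝ, ℝ × F)) 𝓘(ℝ, F) 2 (fun q : ℝ × F => Φ (q.1, ψ.symm q.2)) q := by
    intro q hq
    refine hΦ.contMDiffAt.comp q (ContMDiffAt.prodMk ?_ ?_)
    · exact contDiff_fst.contMDiff.contMDiffAt
    · exact (contMDiffAt_extChartAt_symm x hq).comp q contDiff_snd.contMDiff.contMDiffAt
  have hΦc : ∀ q : ℝ × F, q.2 ∈ ψ.target → Φ (q.1, ψ.symm q.2) ∈ (chartAt F x).source →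
      ContDiffAt ℝ 2 Φc q := by
    intro q hq hq'
    rw [← contMDiffAt_iff_contDiffAt]
    exact (contMDiffAt_extChartAt' hq').comp q (hΦs2 q hq)
  have hKc : ∀ᶠ u in 𝓝 u₀, Kc u = fderiv ℝ Φc (0, u) (1, 0) := by
    filter_upwards [ht] with u hu
    have hy : ψ.symm u ∈ (chartAt F x).source := by
      have := ψ.map_target hu
      rwa [hψ, extChartAt_source] at this
    have h1 : HasFDerivAt Φc (fderiv ℝ Φc (0, u)) (0, u) :=
      ((hΦc (0, u) hu (by simpa [hid] using hy)).differentiableAt (by norm_num)).hasFDerivAt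
    have h2 := h1.comp_hasDerivAt (0 : ℝ)
      ((hasDerivAt_id (0 : ℝ)).prodMk (hasDerivAt_const (0 : ℝ) u))
    have h3 : modelDeriv 𝓘(ℝ, ℝ) 𝓘(ℝ, F) (fun s : ℝ => ψ (Φ (s, ψ.symm u))) 0 1 =
        fderiv ℝ Φc (0, u) (1, 0) := by
      rw [modelDeriv_eq_fderiv, ← h2.deriv]; rfl
    have h4 : MDifferentiableAt 𝓘(ℝ, ℝ) 𝓘(ℝ, F) (fun s : ℝ => Φ (s, ψ.symm u)) 0 := by
      have : ContMDiff 𝓘(ℝ, ℝ) 𝓘(ℝ, F) 2 (fun s : ℝ => Φ (s, ψ.symm u)) :=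
        hΦ.comp (contMDiff_id.prodMk contMDiff_const)
      exact this.contMDiffAt.mdifferentiableAt (by norm_num)
    rw [← h3, modelDeriv_comp_apply (mdifferentiableAt_extChartAt hy) h4 (hid _)]
    simp only [Kc]
    rw [mpullbackWithin_extChartAt_symm_eq x hu, hK]
  have hidc : ∀ᶠ u in 𝓝 u₀, Φc (0, u) = u := by
    filter_upwards [ht] with u hu
    simp [Φc, hid, ψ.right_inv hu]
  have hVc : DifferentiableAt ℝ Vc u₀ := by
    have := MDifferentiableWithinAt.differentiableWithinAt_mpullbackWithin_vectorField
      (mdifferentiableWithinAt_univ.2 hV)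
    have h2 : (extChartAt 𝓘(ℝ, F) x).symm ⁻¹' univ ∩ range 𝓘(ℝ, F) = univ := by simp
    rw [h2] at this
    exact differentiableWithinAt_univ.1 this
  have hsrc : ∀ᶠ s in 𝓝 (0 : ℝ), Φ (s, x) ∈ (chartAt F x).source := by
    have hc : Continuous fun s : ℝ => Φ (s, x) := hΦ.continuous.comp (by fun_prop)
    refine hc.continuousAt.eventually ?_
    simp only [hid]
    exact (chartAt F x).open_source.mem_nhds (mem_chart_source F x)
  have hmain := hasDerivAt_flow_pullback_vectorSpace
    (hΦc (0, u₀) hu₀t (by simp [hid, hψx])) hidc hVc hKc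
  rw [mlieBracket_eq_lieBracket_chart]
  refine hmain.congr_of_eventuallyEq ?_
  filter_upwards [hsrc] with s hs
  set z := Φ (s, x) with hz
  have hzs : z ∈ ψ.source := by rwa [hψ, extChartAt_source]
  have hzt : ψ z ∈ ψ.target := ψ.map_source hzs
  have hzz : ψ.symm (ψ z) = z := ψ.left_inv hzs
  have e1 : Φc (s, u₀) = ψ z := by simp [Φc, hψx, hz]
  rw [e1]
  have hΦs : MDifferentiableAt 𝓘(ℝ, F) 𝓘(ℝ, F) (fun y => Φ (-s, y)) z := by
    have : ContMDiff 𝓘(ℝ, F) 𝓘(ℝ, F) 2 (fun y => Φ (-s, y)) :=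
      hΦ.comp (contMDiff_const.prodMk contMDiff_id)
    exact this.contMDiffAt.mdifferentiableAt (by norm_num)
  have hb : Φ (-s, z) = x := hinv s x
  have hd : DifferentiableAt ℝ Φc (-s, ψ z) :=
    (hΦc (-s, ψ z) hzt (by simp [hzz, hb])).differentiableAt (by norm_num)
  have h5 : fderiv ℝ Φc (-s, ψ z) (0, Vc (ψ z)) =
      modelDeriv 𝓘(ℝ, F) 𝓘(ℝ, F) (fun u => ψ (Φ (-s, ψ.symm u))) (ψ z) (Vc (ψ z)) := by
    rw [modelDeriv_eq_fderiv]
    have := (hd.hasFDerivAt.comp (ψ z) (hasFDerivAt_prodMk_right (𝕜 := ℝ) (-s) (ψ z))).fderiv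
    have h6 : fderiv ℝ (fun u => ψ (Φ (-s, ψ.symm u))) (ψ z) = _ := this
    rw [h6]; simp
  have hsym : MDifferentiableAt 𝓘(ℝ, F) 𝓘(ℝ, F) ψ.symm (ψ z) :=
    (contMDiffAt_extChartAt_symm (n := 2) x hzt).mdifferentiableAt (by norm_num)
  have h7 : MDifferentiableAt 𝓘(ℝ, F) 𝓘(ℝ, F) (fun u => Φ (-s, ψ.symm u)) (ψ z) := by
    exact MDifferentiableAt.comp_of_eq (g := fun y => Φ (-s, y)) (ψ z) hΦs hsym hzz
  rw [h5, modelDeriv_comp_apply (y := x) (mdifferentiableAt_extChartAt (mem_chart_source F x)) h7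
    (by rw [hzz, hb]), modelDeriv_extChartAt_self, modelDeriv_comp_apply (y := z) hΦs hsym hzz]
  simp only [Vc]
  rw [mpullbackWithin_extChartAt_symm_eq x hzt]
  have h8 : ∀ v : F, modelDeriv 𝓘(ℝ, F) 𝓘(ℝ, F) ψ.symm (ψ z)
      (modelDeriv 𝓘(ℝ, F) 𝓘(ℝ, F) ψ (ψ.symm (ψ z)) v) = v := fun v =>
    congrArg (fun A : F →L[ℝ] F => A v) (modelDeriv_extChartAt_symm_comp x hzt)
  have h9 : (V (ψ.symm (ψ z)) : F) = V z := congrArg (fun w => (V w : F)) hzz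
  exact congrArg (modelDeriv 𝓘(ℝ, F) 𝓘(ℝ, F) (fun y => Φ (-s, y)) z) ((h8 _).trans h9).symm

end LieDerivative

/-! ### Killing fields and Noether's theorem -/

section Noether

open VectorField Filter

variable {F : Type*} [NormedAddCommGroup F] [NormedSpace ℝ F]
  {M : Type*} [TopologicalSpace M] [ChartedSpace F M] [IsManifold 𝓘(ℝ, F) ∞ M]

omit [IsManifold 𝓘(ℝ, F) ∞ M] in
/-- The chain rule for a map on a manifold along a curve. -/
theorem hasDerivAt_comp_curve {V : Type*} [NormedAddCommGroup V] [NormedSpace ℝ V] {f : M → V}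
    {c : ℝ → M} {t : ℝ} {y : M}
    (hf : MDifferentiableAt 𝓘(ℝ, F) 𝓘(ℝ, V) f y) (hc : MDifferentiableAt 𝓘(ℝ, ℝ) 𝓘(ℝ, F) c t)
    (hy : c t = y) :
    HasDerivAt (fun s => f (c s))
      (modelDeriv 𝓘(ℝ, F) 𝓘(ℝ, V) f y (modelDeriv 𝓘(ℝ, ℝ) 𝓘(ℝ, F) c t 1)) t := by
  subst hy
  let D : ℝ →L[ℝ] V := (modelDeriv 𝓘(ℝ, F) 𝓘(ℝ, V) f (c t)).comp (modelDeriv 𝓘(ℝ, ℝ) 𝓘(ℝ, F) c t)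
  have h2 : HasMFDerivAt 𝓘(ℝ, ℝ) 𝓘(ℝ, V) (fun s => f (c s)) t D :=
    hf.hasMFDerivAt.comp t hc.hasMFDerivAt
  have h3 : HasFDerivAt (fun s => f (c s)) D t := hasMFDerivAt_iff_hasFDerivAt.1 h2
  exact h3.hasDerivAt

theorem mdifferentiableAt_metric_apply
    (g : ContMDiffRiemannianMetric 𝓘(ℝ, F) ∞ F (fun x : M => TangentSpace 𝓘(ℝ, F) x)) {x : M}
    {V W : ∀ y : M, TangentSpace 𝓘(ℝ, F) y} (hV : MDiffAt (T% V) x) (hW : MDiffAt (T% W) x) :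
    MDifferentiableAt 𝓘(ℝ, F) 𝓘(ℝ, ℝ) (fun y => g.inner y (V y) (W y)) x := by
  have : MDifferentiableAt 𝓘(ℝ, F) (𝓘(ℝ, F).prod 𝓘(ℝ))
      (fun m ↦ TotalSpace.mk' ℝ (E := Bundle.Trivial M ℝ) m (g.inner m (V m) (W m))) x := by
    apply MDifferentiableAt.clm_bundle_apply₂ (F₁ := F) (F₂ := F)
    · exact g.contMDiff.contMDiffAt.mdifferentiableAt (by simp)
    · exact hV
    · exact hW
  simp only [mdifferentiableAt_totalSpace] at this
  exact this.2

theorem mdifferentiableAt_trivialization_symm (x : M) (w : F) :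
    MDiffAt (T% (fun z : M =>
      (trivializationAt F (fun z : M => TangentSpace 𝓘(ℝ, F) z) x).symm z w)) x := by
  have h := FiberBundle.mdifferentiableAt_extend 𝓘(ℝ, F) F
    ((trivializationAt F (fun z : M => TangentSpace 𝓘(ℝ, F) z) x).symm x w)
  unfold FiberBundle.extend at h
  simpa only [Bundle.Trivialization.apply_mk_symm _ (FiberBundle.mem_baseSet_trivializationAt' x)]
    using h

/-- The product rule for the metric along a curve. -/
theorem IsLeviCivita.hasDerivAt_inner_along [FiniteDimensional ℝ F]
    {g : ContMDiffRiemannianMetric 𝓘(ℝ, F) ∞ F (fun x : M => TangentSpace 𝓘(ℝ, F) x)}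
    {nabla : CovariantDerivative 𝓘(ℝ, F) F (fun x : M => TangentSpace 𝓘(ℝ, F) x)}
    (hnabla : IsLeviCivita g nabla) {c : ℝ → M} {Y : ∀ t : ℝ, TangentSpace 𝓘(ℝ, F) (c t)} {t : ℝ}
    (hY : MDifferentiableAt 𝓘(ℝ, ℝ) 𝓘(ℝ, F).tangent
      (fun s => (⟨c s, Y s⟩ : TangentBundle 𝓘(ℝ, F) M)) t)
    {K : ∀ y : M, TangentSpace 𝓘(ℝ, F) y} (hK : MDiffAt (T% K) (c t)) :
    HasDerivAt (fun s => g.inner (c s) (Y s) (K (c s)))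
      (g.inner (c t) (covDerivAlong nabla c Y t) (K (c t)) +
        g.inner (c t) (Y t) (nabla K (c t) (velocity c t))) t := by
  set e := trivializationAt F (fun z : M => TangentSpace 𝓘(ℝ, F) z) (c t) with he
  let η : ℝ → F := fun s => (e (TotalSpace.mk' F (c s) (Y s))).2
  let L : F → ℝ → ℝ := fun w s => g.inner (c s) (e.symm (c s) w) (K (c s))
  have hct : c t ∈ e.baseSet := FiberBundle.mem_baseSet_trivializationAt' (c t)
  rw [mdifferentiableAt_totalSpace] at hY
  obtain ⟨hc, hη⟩ := hY
  have hη' : HasDerivAt η (deriv η t) t := by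
    have : DifferentiableAt ℝ η t := hη.differentiableAt
    exact this.hasDerivAt
  have hev : ∀ᶠ s in 𝓝 t, c s ∈ e.baseSet :=
    hc.continuousAt.eventually (e.open_baseSet.mem_nhds hct)
  have hLadd : ∀ w w' s, c s ∈ e.baseSet → L (w + w') s = L w s + L w' s := by
    intro w w' s hs
    simp only [L]
    have : e.symm (c s) (w + w') = e.symm (c s) w + e.symm (c s) w' := by
      simpa only [Trivialization.coe_symmₗ _ hs] using map_add (e.symmₗ ℝ (c s)) w w'
    rw [this, map_add]; rfl
  have hLsmul : ∀ (a : ℝ) w s, c s ∈ e.baseSet → L (a • w) s = a * L w s := by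
    intro a w s hs
    simp only [L]
    have : e.symm (c s) (a • w) = a • e.symm (c s) w := by
      simpa only [Trivialization.coe_symmₗ _ hs] using map_smul (e.symmₗ ℝ (c s)) a w
    rw [this, map_smul]; rfl
  have hL : ∀ w, HasDerivAt (L w) (g.inner (c t) (nabla (fun y => e.symm y w) (c t) (velocity c t))
      (K (c t)) + g.inner (c t) (e.symm (c t) w) (nabla K (c t) (velocity c t))) t := by
    intro w
    have hw := mdifferentiableAt_trivialization_symm (c t) w
    rw [← hnabla.2 (c t) (velocity c t) _ _ hw hK]
    exact hasDerivAt_comp_curve (mdifferentiableAt_metric_apply g hw hK) hc rfl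
  let b := Module.finBasis ℝ F
  have hsum : ∀ w s, c s ∈ e.baseSet → L w s = ∑ i, b.repr w i * L (b i) s := by
    intro w s hs
    let ℓ : F →ₗ[ℝ] ℝ := ⟨⟨fun w => L w s, fun w w' => hLadd w w' s hs⟩, fun a w => hLsmul a w s hs⟩
    have : ℓ w = ∑ i, b.repr w i • ℓ (b i) := by
      conv_lhs => rw [← b.sum_repr w, map_sum]
      simp only [map_smul]
    exact this
  have hδ : ∀ i, HasDerivAt (fun s => b.repr (η s - η t) i) (b.repr (deriv η t) i) t := by
    intro i
    have h1 := (LinearMap.toContinuousLinearMap (b.coord i)).hasFDerivAt.comp_hasDerivAt t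
      (hη'.sub_const (η t))
    exact h1
  -- `Y` is the sum of the field with constant components `η t` and the one with components
  -- `η s - η t`; the latter vanishes at `t`, so that only its components are differentiated
  have hδL : HasDerivAt (fun s => L (η s - η t) s) (L (deriv η t) t) t := by
    have h1 : HasDerivAt (fun s => ∑ i, b.repr (η s - η t) i * L (b i) s) _ t :=
      HasDerivAt.fun_sum fun i _ => (hδ i).mul (hL (b i))
    simp only [sub_self, map_zero, Finsupp.coe_zero, Pi.zero_apply, zero_mul, add_zero] at h1
    rw [← hsum _ _ hct] at h1
    exact h1.congr_of_eventuallyEq (hev.mono fun s hs => hsum _ _ hs)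
  have hfin := hδL.add (hL (η t))
  have hYs : ∀ s, c s ∈ e.baseSet → e.symm (c s) (η s) = Y s := fun s hs =>
    e.symm_apply_apply_mk hs (Y s)
  refine (hfin.congr_of_eventuallyEq ?_).congr_deriv ?_
  · filter_upwards [hev] with s hs
    simp only [Pi.add_apply]
    rw [← hLadd _ _ _ hs, sub_add_cancel]
    simp only [L]
    rw [hYs s hs]
  · have h1 : covDerivAlong nabla c Y t = e.symm (c t) (deriv η t) +
        nabla (fun y => e.symm y (η t)) (c t) (velocity c t) := rfl
    rw [h1, map_add, hYs t hct, ← add_assoc]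
    rfl

/-- Partial differentials of a smooth family of maps `f`, applied to a smooth family of tangent
vectors `p`, form a smooth map into the tangent bundle. -/
theorem ContMDiffAt.mfderiv_totalSpace {E H N E' H' M' E'' H'' M'' : Type*}
    [NormedAddCommGroup E] [NormedSpace ℝ E] [TopologicalSpace H] [TopologicalSpace N]
    [ChartedSpace H N] {J : ModelWithCorners ℝ E H}
    [NormedAddCommGroup E'] [NormedSpace ℝ E'] [TopologicalSpace H'] [TopologicalSpace M']
    [ChartedSpace H' M'] {I' : ModelWithCorners ℝ E' H'}
    [NormedAddCommGroup E''] [NormedSpace ℝ E''] [TopologicalSpace H''] [TopologicalSpace M'']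
    [ChartedSpace H'' M''] {I'' : ModelWithCorners ℝ E'' H''}
    {m n : WithTop ℕ∞} [IsManifold J n N] [IsManifold J 1 N] [IsManifold I' n M']
    [IsManifold I'' n M''] [IsManifold I' 1 M'] [IsManifold I'' 1 M''] {f : N → M' → M''} {p : N → TangentBundle I' M'}
    {x₀ : N}
    (hf : ContMDiffAt (J.prod I') I'' n (Function.uncurry f) (x₀, (p x₀).1))
    (hp : ContMDiffAt J I'.tangent m p x₀) (hmn : m + 1 ≤ n) :
    ContMDiffAt J I''.tangent m
      (fun x => (⟨f x (p x).1, mfderiv I' I'' (f x) (p x).1 (p x).2⟩ : TangentBundle I'' M''))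
      x₀ := by
  have hb : ContMDiffAt J I' m (fun x => (p x).1) x₀ := (contMDiffAt_totalSpace.1 hp).1
  have hϕ := ContMDiffAt.mfderiv f (fun x => (p x).1) hf hb hmn
  have hb₂ : ContMDiffAt J I'' m (fun x => f x (p x).1) x₀ :=
    ContMDiffAt.comp x₀ (g := Function.uncurry f) (f := fun x => (x, (p x).1))
      (hf.of_le (le_self_add.trans hmn)) (contMDiffAt_id.prodMk hb)
  exact ContMDiffAt.clm_apply_of_inCoordinates hϕ hp hb₂

/-- A map into a single tangent space is as smooth as a map into the tangent bundle as it is as a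
map into the model space. -/
theorem contMDiffAt_mk_tangentSpace {E H N : Type*}
    [NormedAddCommGroup E] [NormedSpace ℝ E] [TopologicalSpace H] [TopologicalSpace N]
    [ChartedSpace H N] {J : ModelWithCorners ℝ E H} {m : WithTop ℕ∞} {β : N → F} {y₀ : N} (x : M) :
    ContMDiffAt J 𝓘(ℝ, F).tangent m (fun y => (⟨x, β y⟩ : TangentBundle 𝓘(ℝ, F) M)) y₀ ↔
      ContMDiffAt J 𝓘(ℝ, F) m β y₀ := by
  have h : ∀ v : F, (trivializationAt F (TangentSpace 𝓘(ℝ, F)) x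
      (⟨x, v⟩ : TangentBundle 𝓘(ℝ, F) M)).2 = v := by
    intro v
    exact (tangentBundleCore 𝓘(ℝ, F) M).coordChange_self (achart F x) x (mem_chart_source F x) v
  rw [contMDiffAt_totalSpace]
  simp only [h]
  exact and_iff_right contMDiffAt_const

/-- The metric at equal points, on vectors of the model space. -/
theorem metric_inner_congr
    (g : ContMDiffRiemannianMetric 𝓘(ℝ, F) ∞ F (fun x : M => TangentSpace 𝓘(ℝ, F) x)) {x y : M}
    (h : x = y) (u v : F) : g.inner x u v = g.inner y u v := by
  subst h; rfl

/-- The Killing equation: the generator `K` of a one-parameter group of isometries `Φ` satisfies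
`g (∇_v K, v) = 0`. -/
theorem IsLeviCivita.inner_nabla_killing [FiniteDimensional ℝ F]
    {g : ContMDiffRiemannianMetric 𝓘(ℝ, F) ∞ F (fun x : M => TangentSpace 𝓘(ℝ, F) x)}
    {nabla : CovariantDerivative 𝓘(ℝ, F) F (fun x : M => TangentSpace 𝓘(ℝ, F) x)}
    (hnabla : IsLeviCivita g nabla) {Φ : ℝ × M → M}
    (hΦ : ContMDiff (𝓘(ℝ, ℝ).prod 𝓘(ℝ, F)) 𝓘(ℝ, F) 2 Φ) (hid : ∀ y, Φ (0, y) = y)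
    (hinv : ∀ s y, Φ (-s, Φ (s, y)) = y)
    (hiso : ∀ s y (u v : F), g.inner (Φ (s, y))
      (modelDeriv 𝓘(ℝ, F) 𝓘(ℝ, F) (fun z => Φ (s, z)) y u)
      (modelDeriv 𝓘(ℝ, F) 𝓘(ℝ, F) (fun z => Φ (s, z)) y v) = g.inner y u v)
    {K : ∀ y : M, TangentSpace 𝓘(ℝ, F) y}
    (hK : ∀ y, (K y : F) = modelDeriv 𝓘(ℝ, ℝ) 𝓘(ℝ, F) (fun s : ℝ => Φ (s, y)) 0 1) {x : M}
    (hKd : MDiffAt (T% K) x) (v : TangentSpace 𝓘(ℝ, F) x) :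
    g.inner x (nabla K x v) v = 0 := by
  have : CompleteSpace F := FiniteDimensional.complete ℝ F
  let V : ∀ y : M, TangentSpace 𝓘(ℝ, F) y := FiberBundle.extend F v
  have hVx : V x = v := FiberBundle.extend_apply_self F v
  have hV : MDiffAt (T% V) x := FiberBundle.mdifferentiableAt_extend 𝓘(ℝ, F) F v
  have hc : ContMDiff 𝓘(ℝ, ℝ) 𝓘(ℝ, F) 2 (fun s : ℝ => Φ (s, x)) :=
    hΦ.comp (contMDiff_id.prodMk contMDiff_const)
  -- Differentiate `g (V, V)` along the orbit of `x` in two ways: with the connection, and after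
  -- pulling `V` back to `x` by the flow, which does not change its length.
  have h1 := hasDerivAt_comp_curve (mdifferentiableAt_metric_apply g hV hV)
    (hc.contMDiffAt.mdifferentiableAt (by norm_num) (x := 0)) (hid x)
  rw [← hK] at h1
  have h2 : (modelDeriv 𝓘(ℝ, F) 𝓘(ℝ, ℝ) (fun y => g.inner y (V y) (V y)) x (K x) : ℝ) = _ :=
    hnabla.2 x (K x) V V hV hV
  rw [h2, hVx] at h1
  let G : F →L[ℝ] F →L[ℝ] ℝ := g.inner x
  have hA := hasDerivAt_flow_pullback hΦ hid hinv hK hV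
  have h3 := (G.hasFDerivAt.comp_hasDerivAt (0 : ℝ) hA).clm_apply hA
  have e0 : modelDeriv 𝓘(ℝ, F) 𝓘(ℝ, F) (fun y => Φ (-(0 : ℝ), y)) (Φ (0, x)) (V (Φ (0, x))) = v := by
    have : (fun y => Φ (-(0 : ℝ), y)) = fun y => y := by ext y; simp [hid]
    rw [this, modelDeriv_id]
    have h5 : (V (Φ (0, x)) : F) = V x := congrArg (fun w => (V w : F)) (hid x)
    exact h5.trans hVx
  have h4 : (fun s : ℝ => g.inner (Φ (s, x)) (V (Φ (s, x))) (V (Φ (s, x)))) = fun s : ℝ =>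
      G (modelDeriv 𝓘(ℝ, F) 𝓘(ℝ, F) (fun y => Φ (-s, y)) (Φ (s, x)) (V (Φ (s, x))))
        (modelDeriv 𝓘(ℝ, F) 𝓘(ℝ, F) (fun y => Φ (-s, y)) (Φ (s, x)) (V (Φ (s, x)))) := by
    ext s
    exact (hiso (-s) (Φ (s, x)) (V (Φ (s, x))) (V (Φ (s, x)))).symm.trans
      (metric_inner_congr g (hinv s x) _ _)
  rw [h4] at h1
  have h5 := h1.unique h3
  simp only [Function.comp_apply] at h5
  rw [e0] at h5
  have h6 : (nabla V x (K x) - nabla K x v : F) = mlieBracket 𝓘(ℝ, F) K V x := by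
    have := (CovariantDerivative.torsion_eq_zero_iff nabla).1 hnabla.1 hKd hV
    rw [← hVx]; exact this
  rw [← h6] at h5
  have h7 : ∀ a b : F, G a b = G b a := fun a b => g.symm x a b
  have key : ∀ a b w : F, G a w + G w a = G (a - b) w + G w (a - b) → G b w = 0 := by
    intro a b w h
    rw [h7 w, h7 w, map_sub, sub_apply] at h
    linarith
  exact key _ _ _ h5

/-- Noether's theorem for the symmetry given by a one-parameter group of isometries `Φ` with
generator `K`: the derivative of `g (c', K)` along a curve `c` is `g (∇_{c'} c', K)`. -/
theorem IsLeviCivita.hasDerivAt_inner_velocity_killing [FiniteDimensional ℝ F]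
    {g : ContMDiffRiemannianMetric 𝓘(ℝ, F) ∞ F (fun x : M => TangentSpace 𝓘(ℝ, F) x)}
    {nabla : CovariantDerivative 𝓘(ℝ, F) F (fun x : M => TangentSpace 𝓘(ℝ, F) x)}
    (hnabla : IsLeviCivita g nabla) {Φ : ℝ × M → M}
    (hΦ : ContMDiff (𝓘(ℝ, ℝ).prod 𝓘(ℝ, F)) 𝓘(ℝ, F) 2 Φ) (hid : ∀ y, Φ (0, y) = y)
    (hinv : ∀ s y, Φ (-s, Φ (s, y)) = y)
    (hiso : ∀ s y (u v : F), g.inner (Φ (s, y))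
      (modelDeriv 𝓘(ℝ, F) 𝓘(ℝ, F) (fun z => Φ (s, z)) y u)
      (modelDeriv 𝓘(ℝ, F) 𝓘(ℝ, F) (fun z => Φ (s, z)) y v) = g.inner y u v)
    {K : ∀ y : M, TangentSpace 𝓘(ℝ, F) y}
    (hK : ∀ y, (K y : F) = modelDeriv 𝓘(ℝ, ℝ) 𝓘(ℝ, F) (fun s : ℝ => Φ (s, y)) 0 1)
    {c : ℝ → M} {t : ℝ} (hKd : MDiffAt (T% K) (c t))
    (hc : ContMDiffAt 𝓘(ℝ, ℝ) 𝓘(ℝ, F) 2 c t) :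
    HasDerivAt (fun s => g.inner (c s) (velocity c s) (K (c s)))
      (g.inner (c t) (covDerivAlong nabla c (velocity c) t) (K (c t))) t := by
  have hvel : MDifferentiableAt 𝓘(ℝ, ℝ) 𝓘(ℝ, F).tangent
      (fun s => (⟨c s, velocity c s⟩ : TangentBundle 𝓘(ℝ, F) M)) t := by
    have h1 : ContMDiffAt 𝓘(ℝ, ℝ) 𝓘(ℝ, ℝ).tangent 1
        (fun s : ℝ => (⟨s, (1 : ℝ)⟩ : TangentBundle 𝓘(ℝ, ℝ) ℝ)) t :=
      contMDiffAt_vectorSpace_iff_contDiffAt.2 contDiffAt_const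
    have h2 : ContMDiffAt (𝓘(ℝ, ℝ).prod 𝓘(ℝ, ℝ)) 𝓘(ℝ, F) 2
        (Function.uncurry fun _ : ℝ => c) (t, t) := hc.comp (t, t) contMDiffAt_snd
    have h3 := ContMDiffAt.mfderiv_totalSpace (f := fun _ : ℝ => c) h2 h1 (by norm_num)
    exact h3.mdifferentiableAt (by norm_num)
  have := hnabla.hasDerivAt_inner_along hvel hKd
  rwa [g.symm (c t) (velocity c t), hnabla.inner_nabla_killing hΦ hid hinv hiso hK hKd,
    add_zero] at this

end Noether

/-! ### The exponential map and the adjoint representation -/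

section IntegralCurveSmooth

variable {F : Type*} [NormedAddCommGroup F] [NormedSpace ℝ F]
  {M : Type*} [TopologicalSpace M] [ChartedSpace F M] [IsManifold 𝓘(ℝ, F) ∞ M]

/-- An integral curve of a `C^n` vector field which is `C^n` is even `C^(n+1)`. -/
theorem IsMIntegralCurve.contMDiff_succ {V : ∀ y : M, TangentSpace 𝓘(ℝ, F) y} {γ : ℝ → M} {n : ℕ}
    (hγ : IsMIntegralCurve (I := 𝓘(ℝ, F)) γ V)
    (hV : ContMDiff 𝓘(ℝ, F) 𝓘(ℝ, F).tangent n (T% V)) (hn : ContMDiff 𝓘(ℝ, ℝ) 𝓘(ℝ, F) n γ) :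
    ContMDiff 𝓘(ℝ, ℝ) 𝓘(ℝ, F) (n + 1) γ := by
  intro t
  rw [contMDiffAt_iff_target]
  refine ⟨hn.continuous.continuousAt, ?_⟩
  rw [contMDiffAt_iff_contDiffAt]
  have h1 : ContMDiffAt 𝓘(ℝ, ℝ) 𝓘(ℝ, F).tangent n
      (fun s => (⟨γ s, V (γ s)⟩ : TangentBundle 𝓘(ℝ, F) M)) t := hV.contMDiffAt.comp t hn.contMDiffAt
  have h2 := (contMDiffAt_iff_contDiffAt.1 (contMDiffAt_totalSpace.1 h1).2)
  rw [contDiffAt_succ_iff_hasFDerivAt]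
  obtain ⟨u, hu, hu'⟩ := (hγ.isMIntegralCurveAt t).eventually_hasDerivAt.exists_mem
  refine ⟨fun s => (1 : ℝ →L[ℝ] ℝ).smulRight ((trivializationAt F (TangentSpace 𝓘(ℝ, F)) (γ t)
      (⟨γ s, V (γ s)⟩ : TangentBundle 𝓘(ℝ, F) M)).2), ⟨u, hu, fun s hs => ?_⟩, ?_⟩
  · exact (hu' s hs).hasFDerivAt
  · exact contDiffAt_const.smulRight h2

end IntegralCurveSmooth

section LieGroup

variable {E : Type*} [NormedAddCommGroup E] [NormedSpace ℝ E]
  {G : Type*} [TopologicalSpace G] [ChartedSpace E G] [Group G] [LieGroup 𝓘(ℝ, E) ∞ G]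

theorem mdifferentiable_leftMul (p : G) : MDifferentiable 𝓘(ℝ, E) 𝓘(ℝ, E) (fun q : G => p * q) :=
  (contMDiff_mul_left (I := 𝓘(ℝ, E)) (n := ∞)).mdifferentiable (by simp)

theorem mdifferentiable_rightMul (p : G) : MDifferentiable 𝓘(ℝ, E) 𝓘(ℝ, E) (fun q : G => q * p) :=
  (contMDiff_mul_right (I := 𝓘(ℝ, E)) (n := ∞)).mdifferentiable (by simp)

theorem contMDiff_conj :
    ContMDiff (𝓘(ℝ, E).prod 𝓘(ℝ, E)) 𝓘(ℝ, E) ∞ (fun x : G × G => x.1 * x.2 * x.1⁻¹) :=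
  (contMDiff_fst.mul contMDiff_snd).mul contMDiff_fst.inv

theorem mdifferentiable_conj (p : G) :
    MDifferentiable 𝓘(ℝ, E) 𝓘(ℝ, E) (fun q : G => p * q * p⁻¹) :=
  ((contMDiff_const.mul contMDiff_id).mul contMDiff_const : ContMDiff 𝓘(ℝ, E) 𝓘(ℝ, E) ∞
    (fun q : G => p * q * p⁻¹)).mdifferentiable (by simp)

/-- The adjoint representation of a Lie group. -/
def lieAd (p : G) : E →L[ℝ] E := modelDeriv 𝓘(ℝ, E) 𝓘(ℝ, E) (fun q : G => p * q * p⁻¹) 1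

omit [LieGroup 𝓘(ℝ, E) ∞ G] in
theorem lieAd_one : lieAd (1 : G) = ContinuousLinearMap.id ℝ E := by
  simp [lieAd, modelDeriv_id]

theorem lieAd_mul (p q : G) (Z : E) : lieAd (p * q) Z = lieAd p (lieAd q Z) := by
  have := modelDeriv_comp_apply (y := (1 : G)) (mdifferentiable_conj p 1)
    (mdifferentiable_conj (E := E) q 1) (by simp) Z
  rw [lieAd, lieAd, lieAd, ← this]
  congr 2
  ext r; simp [mul_assoc]

theorem lieAd_inv_apply (p : G) (Z : E) : lieAd p⁻¹ (lieAd p Z) = Z := by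
  rw [← lieAd_mul, inv_mul_cancel, lieAd_one]; rfl

theorem lieAd_apply_inv (p : G) (Z : E) : lieAd p (lieAd p⁻¹ Z) = Z := by
  rw [← lieAd_mul, mul_inv_cancel, lieAd_one]; rfl

omit [Group G] [LieGroup 𝓘(ℝ, E) ∞ G] in
theorem tangentBundle_mk_congr {x y : G} (h : x = y) (v : E) :
    (⟨x, v⟩ : TangentBundle 𝓘(ℝ, E) G) = ⟨y, v⟩ := by subst h; rfl

theorem contMDiff_lieAd (Z : E) : ContMDiff 𝓘(ℝ, E) 𝓘(ℝ, E) ∞ (fun p : G => lieAd p Z) := by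
  intro p
  have h := ContMDiffAt.mfderiv_totalSpace (J := 𝓘(ℝ, E)) (I'' := 𝓘(ℝ, E)) (m := ∞) (n := ∞)
    (f := fun p q : G => p * q * p⁻¹)
    (p := fun _ => (⟨1, Z⟩ : TangentBundle 𝓘(ℝ, E) G)) (x₀ := p)
    contMDiff_conj.contMDiffAt contMDiffAt_const (by simp)
  rw [← contMDiffAt_mk_tangentSpace (M := G) 1]
  refine h.congr_of_eventuallyEq (Filter.Eventually.of_forall fun q => ?_)
  exact tangentBundle_mk_congr (by simp) _

theorem mdifferentiable_lieAd (Z : E) :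
    MDifferentiable 𝓘(ℝ, E) 𝓘(ℝ, E) (fun p : G => lieAd p Z) :=
  (contMDiff_lieAd Z).mdifferentiable (by simp)

/-- The velocity of a curve in a Lie group, translated to the identity from the left. -/
def bodyVelocity (p : ℝ → G) (t : ℝ) : E :=
  modelDeriv 𝓘(ℝ, ℝ) 𝓘(ℝ, E) (fun s => (p t)⁻¹ * p s) t 1

/-- The chain rule along a curve in a Lie group, in terms of its body velocity. -/
theorem modelDeriv_comp_curve {E' H' N : Type*} [NormedAddCommGroup E'] [NormedSpace ℝ E']
    [TopologicalSpace H'] {I' : ModelWithCorners ℝ E' H'} [TopologicalSpace N] [ChartedSpace H' N]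
    {f : G → N} {p : ℝ → G} {t : ℝ} (hf : MDifferentiableAt 𝓘(ℝ, E) I' f (p t))
    (hp : MDifferentiableAt 𝓘(ℝ, ℝ) 𝓘(ℝ, E) p t) :
    modelDeriv 𝓘(ℝ, ℝ) I' (fun s => f (p s)) t 1 =
      modelDeriv 𝓘(ℝ, E) I' (fun q => f (p t * q)) 1 (bodyVelocity p t) := by
  have h1 : MDifferentiableAt 𝓘(ℝ, E) I' (fun q => f (p t * q)) 1 :=
    MDifferentiableAt.comp_of_eq (1 : G) hf (mdifferentiable_leftMul (E := E) (p t) 1) (by simp)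
  have h2 : MDifferentiableAt 𝓘(ℝ, ℝ) 𝓘(ℝ, E) (fun s => (p t)⁻¹ * p s) t :=
    MDifferentiableAt.comp t (mdifferentiable_leftMul (E := E) (p t)⁻¹ _) hp
  rw [bodyVelocity, ← modelDeriv_comp_apply h1 h2 (by simp)]
  simp

omit [LieGroup 𝓘(ℝ, E) ∞ G] in
theorem mulInvariantVectorField_eq (X : GroupLieAlgebra 𝓘(ℝ, E) G) (p : G) :
    (mulInvariantVectorField X p : E) = modelDeriv 𝓘(ℝ, E) 𝓘(ℝ, E) (fun q => p * q) 1 X := rfl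

theorem modelDeriv_leftMul_comp (X : E) (p q : G) :
    modelDeriv 𝓘(ℝ, E) 𝓘(ℝ, E) (fun r => p * r) q
        (modelDeriv 𝓘(ℝ, E) 𝓘(ℝ, E) (fun r => q * r) 1 X) =
      modelDeriv 𝓘(ℝ, E) 𝓘(ℝ, E) (fun r => p * q * r) 1 X := by
  rw [← modelDeriv_comp_apply (y := q)
    (mdifferentiable_leftMul p _) (mdifferentiable_leftMul q _) (mul_one q)]
  simp [mul_assoc]

theorem comp_smulRight_one {V W : Type*} [NormedAddCommGroup V] [NormedSpace ℝ V]
    [NormedAddCommGroup W] [NormedSpace ℝ W] (A : V →L[ℝ] W) (v : V) {w : W} (h : A v = w) :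
    A.comp ((1 : ℝ →L[ℝ] ℝ).smulRight v) = (1 : ℝ →L[ℝ] ℝ).smulRight w := by
  ext; simp [h]

theorem IsMIntegralCurve.const_mul {X : GroupLieAlgebra 𝓘(ℝ, E) G} {γ : ℝ → G}
    (hγ : IsMIntegralCurve (I := 𝓘(ℝ, E)) γ (mulInvariantVectorField X)) (p : G) :
    IsMIntegralCurve (I := 𝓘(ℝ, E)) (fun t => p * γ t) (mulInvariantVectorField X) := by
  intro t
  have h := (mdifferentiable_leftMul (E := E) p (γ t)).hasMFDerivAt.comp t (hγ t)
  exact h.congr_mfderiv (comp_smulRight_one (modelDeriv 𝓘(ℝ, E) 𝓘(ℝ, E) (fun r => p * r) (γ t)) _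
    (modelDeriv_leftMul_comp (E := E) X p (γ t)))

theorem contMDiff_mulInvariantVectorField_two (X : GroupLieAlgebra 𝓘(ℝ, E) G) :
    ContMDiff 𝓘(ℝ, E) 𝓘(ℝ, E).tangent 2
      (fun g : G => (⟨g, mulInvariantVectorField X g⟩ : TangentBundle 𝓘(ℝ, E) G)) := by
  have : LieGroup 𝓘(ℝ, E) (minSmoothness ℝ 3) G := lieGroup_minSmoothness
  exact (contMDiff_mulInvariantVectorField X).of_le
    (by rw [minSmoothness_of_isRCLikeNormedField])

variable [FiniteDimensional ℝ E] [T2Space G]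

theorem mulInvariant_integralCurve_unique {X : GroupLieAlgebra 𝓘(ℝ, E) G} {γ γ' : ℝ → G}
    (hγ : IsMIntegralCurve (I := 𝓘(ℝ, E)) γ (mulInvariantVectorField X))
    (hγ' : IsMIntegralCurve (I := 𝓘(ℝ, E)) γ' (mulInvariantVectorField X)) (h0 : γ 0 = γ' 0) :
    γ = γ' := by
  have : CompleteSpace E := FiniteDimensional.complete ℝ E
  exact isMIntegralCurve_Ioo_eq_of_contMDiff_boundaryless (t₀ := 0)
    ((contMDiff_mulInvariantVectorField_two X).of_le (by norm_num)) hγ hγ' h0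

theorem lieExp_smul_eq {X : GroupLieAlgebra 𝓘(ℝ, E) G} {γ : ℝ → G} (h0 : γ 0 = 1)
    (hγ : IsMIntegralCurve (I := 𝓘(ℝ, E)) γ (mulInvariantVectorField X)) (t : ℝ) :
    lieExp (t • X) = γ t := by
  have h1 := (exists_integralCurve_mulInvariantVectorField (t • X)).choose_spec
  have h2 : IsMIntegralCurve (I := 𝓘(ℝ, E)) (γ ∘ (· * t)) (mulInvariantVectorField (t • X)) := by
    rw [mulInvariantVectorField_smul]
    exact hγ.comp_mul t
  have h3 := mulInvariant_integralCurve_unique h1.2 h2 (by simp [h1.1, h0])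
  have := congrFun h3 1
  simpa [lieExp] using this

theorem isMIntegralCurve_lieExp (X : GroupLieAlgebra 𝓘(ℝ, E) G) :
    IsMIntegralCurve (I := 𝓘(ℝ, E)) (fun t : ℝ => lieExp (t • X)) (mulInvariantVectorField X) := by
  obtain ⟨γ, h0, hγ⟩ := exists_integralCurve_mulInvariantVectorField X
  have : (fun t : ℝ => lieExp (t • X)) = γ := funext fun t => lieExp_smul_eq h0 hγ t
  rwa [this]

theorem lieExp_zero : lieExp (0 : GroupLieAlgebra 𝓘(ℝ, E) G) = 1 := by
  obtain ⟨γ, h0, hγ⟩ := exists_integralCurve_mulInvariantVectorField (0 : GroupLieAlgebra 𝓘(ℝ, E) G)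
  have := lieExp_smul_eq h0 hγ 0
  rwa [zero_smul, h0] at this

theorem lieExp_add_smul (X : GroupLieAlgebra 𝓘(ℝ, E) G) (s t : ℝ) :
    lieExp ((s + t) • X) = lieExp (s • X) * lieExp (t • X) := by
  have h1 := (isMIntegralCurve_lieExp X).comp_add s
  have h2 := (isMIntegralCurve_lieExp X).const_mul (lieExp (s • X))
  have h3 := mulInvariant_integralCurve_unique h1 h2 (by simp [lieExp_zero])
  have := congrFun h3 t
  simpa [add_comm] using this

theorem lieExp_neg_smul (X : GroupLieAlgebra 𝓘(ℝ, E) G) (t : ℝ) :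
    lieExp ((-t) • X) = (lieExp (t • X))⁻¹ := by
  rw [eq_inv_iff_mul_eq_one, ← lieExp_add_smul, neg_add_cancel, zero_smul, lieExp_zero]

theorem contMDiff_lieExp_smul (X : GroupLieAlgebra 𝓘(ℝ, E) G) :
    ContMDiff 𝓘(ℝ, ℝ) 𝓘(ℝ, E) 2 (fun t : ℝ => lieExp (t • X)) := by
  have h := isMIntegralCurve_lieExp X
  have hV := contMDiff_mulInvariantVectorField_two X
  have h0 : ContMDiff 𝓘(ℝ, ℝ) 𝓘(ℝ, E) (0 : ℕ) (fun t : ℝ => lieExp (t • X)) :=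
    contMDiff_zero_iff.2 h.continuous
  have h1 := h.contMDiff_succ (hV.of_le (by norm_num)) h0
  have h2 := h.contMDiff_succ (n := 1) (hV.of_le (by norm_num)) (by simpa using h1)
  have e : (((1 : ℕ) : WithTop ℕ∞) + 1) = 2 := by norm_num
  rwa [e] at h2

theorem modelDeriv_lieExp_smul (X : GroupLieAlgebra 𝓘(ℝ, E) G) :
    modelDeriv 𝓘(ℝ, ℝ) 𝓘(ℝ, E) (fun t : ℝ => (lieExp (t • X) : G)) 0 1 = X := by
  have h1 : (mulInvariantVectorField X (lieExp ((0 : ℝ) • X) : G) : E) = X := by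
    rw [mulInvariantVectorField_eq, zero_smul, lieExp_zero]
    simp only [one_mul, modelDeriv_id]
    rfl
  refine (congrArg (fun A : ℝ →L[ℝ] E => A 1) (isMIntegralCurve_lieExp X 0).modelDeriv).trans ?_
  refine Eq.trans ?_ h1
  exact one_smul ℝ (mulInvariantVectorField X (lieExp ((0 : ℝ) • X) : G) : E)

end LieGroup

/-! ### The Lie bracket and the derivative of the adjoint representation -/

section LieGroupBracket

variable {E : Type*} [NormedAddCommGroup E] [NormedSpace ℝ E]
  {G : Type*} [TopologicalSpace G] [ChartedSpace E G] [Group G] [LieGroup 𝓘(ℝ, E) ∞ G]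

theorem hasMFDerivAt_curve {F H N : Type*} [NormedAddCommGroup F] [NormedSpace ℝ F]
    [TopologicalSpace H] [TopologicalSpace N] [ChartedSpace H N] {I : ModelWithCorners ℝ F H}
    {c : ℝ → N} {t : ℝ} (hc : MDifferentiableAt 𝓘(ℝ, ℝ) I c t) {v : F}
    (hv : modelDeriv 𝓘(ℝ, ℝ) I c t 1 = v) :
    HasMFDerivAt 𝓘(ℝ, ℝ) I c t ((1 : ℝ →L[ℝ] ℝ).smulRight v) := by
  have h : modelDeriv 𝓘(ℝ, ℝ) I c t = (1 : ℝ →L[ℝ] ℝ).smulRight v := by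
    ext; simp [hv]
  exact hc.hasMFDerivAt.congr_mfderiv h

variable (G) in
/-- The Lie bracket of a Lie group as the differential of the adjoint representation, on the model
vector space. -/
def lieBr (X Z : E) : E := modelDeriv 𝓘(ℝ, E) 𝓘(ℝ, E) (fun q : G => lieAd q Z) 1 X

omit [LieGroup 𝓘(ℝ, E) ∞ G] in
theorem lieBr_add_left (X Y Z : E) : lieBr G (X + Y) Z = lieBr G X Z + lieBr G Y Z :=
  map_add _ _ _

omit [LieGroup 𝓘(ℝ, E) ∞ G] in
theorem lieBr_smul_left (a : ℝ) (X Z : E) : lieBr G (a • X) Z = a • lieBr G X Z :=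
  map_smul _ _ _

/-- The derivative of `Ad p Z` along a curve `p` with body velocity `ξ` is `Ad p [ξ, Z]`. -/
theorem hasDerivAt_lieAd_curve {p : ℝ → G} {t : ℝ} (hp : MDifferentiableAt 𝓘(ℝ, ℝ) 𝓘(ℝ, E) p t)
    (Z : E) :
    HasDerivAt (fun s => lieAd (p s) Z) (lieAd (p t) (lieBr G (bodyVelocity p t) Z)) t := by
  have h2 : MDifferentiableAt 𝓘(ℝ, ℝ) 𝓘(ℝ, E) (fun s => (p t)⁻¹ * p s) t :=
    MDifferentiableAt.comp t (mdifferentiable_leftMul (E := E) (p t)⁻¹ _) hp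
  have h3 := hasDerivAt_comp_curve (mdifferentiable_lieAd Z 1) h2 (by simp)
  have h4 := (lieAd (E := E) (p t)).hasFDerivAt.comp_hasDerivAt t h3
  refine h4.congr_of_eventuallyEq (Filter.Eventually.of_forall fun s => ?_)
  simp [← lieAd_mul]

/-- The body velocity of a one-parameter subgroup is constant. -/
theorem bodyVelocity_of_add {γ : ℝ → G} (hγ : MDifferentiableAt 𝓘(ℝ, ℝ) 𝓘(ℝ, E) γ 0)
    (hadd : ∀ s t, γ (s + t) = γ s * γ t) (t : ℝ) :
    MDifferentiableAt 𝓘(ℝ, ℝ) 𝓘(ℝ, E) γ t ∧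
      bodyVelocity (E := E) γ t = modelDeriv 𝓘(ℝ, ℝ) 𝓘(ℝ, E) γ 0 1 := by
  have hsub : HasDerivAt (fun s : ℝ => s - t) 1 t := (hasDerivAt_id t).sub_const t
  have hsubm : MDifferentiableAt 𝓘(ℝ, ℝ) 𝓘(ℝ, ℝ) (fun s : ℝ => s - t) t :=
    hsub.differentiableAt.mdifferentiableAt
  have h1 : MDifferentiableAt 𝓘(ℝ, ℝ) 𝓘(ℝ, E) (fun s => γ (s - t)) t :=
    MDifferentiableAt.comp_of_eq t hγ hsubm (by simp)
  have e : (fun s => γ t * γ (s - t)) = γ := by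
    ext s; rw [← hadd]; simp
  refine ⟨?_, ?_⟩
  · rw [← e]
    exact MDifferentiableAt.comp t (mdifferentiable_leftMul (E := E) (γ t) _) h1
  · have e2 : (fun s => (γ t)⁻¹ * γ s) = fun s => γ (s - t) := by
      ext s; rw [inv_mul_eq_iff_eq_mul, ← hadd]; simp
    rw [bodyVelocity, e2, modelDeriv_comp_apply (y := (0 : ℝ)) hγ hsubm (by simp),
      modelDeriv_eq_fderiv]
    congr 1
    simp

variable [FiniteDimensional ℝ E] [T2Space G]

theorem mdifferentiable_lieExp_smul (X : GroupLieAlgebra 𝓘(ℝ, E) G) :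
    MDifferentiable 𝓘(ℝ, ℝ) 𝓘(ℝ, E) (fun t : ℝ => (lieExp (t • X) : G)) :=
  (contMDiff_lieExp_smul X).mdifferentiable (by norm_num)

theorem bodyVelocity_lieExp_smul (X : GroupLieAlgebra 𝓘(ℝ, E) G) (t : ℝ) :
    bodyVelocity (E := E) (fun t : ℝ => (lieExp (t • X) : G)) t = X := by
  rw [(bodyVelocity_of_add (mdifferentiable_lieExp_smul X 0) (lieExp_add_smul X) t).2,
    modelDeriv_lieExp_smul]

/-- A differentiable one-parameter subgroup is given by the exponential map. -/
theorem eq_lieExp_of_add {γ : ℝ → G} (hγ : MDifferentiableAt 𝓘(ℝ, ℝ) 𝓘(ℝ, E) γ 0)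
    (h0 : γ 0 = 1) (hadd : ∀ s t, γ (s + t) = γ s * γ t) {X : GroupLieAlgebra 𝓘(ℝ, E) G}
    (hX : modelDeriv 𝓘(ℝ, ℝ) 𝓘(ℝ, E) γ 0 1 = X) (t : ℝ) : γ t = lieExp (t • X) := by
  refine (lieExp_smul_eq h0 (fun t => ?_) t).symm
  obtain ⟨h1, h2⟩ := bodyVelocity_of_add hγ hadd t
  refine hasMFDerivAt_curve h1 ?_
  have := modelDeriv_comp_curve (I' := 𝓘(ℝ, E)) (f := fun q : G => q) mdifferentiableAt_id h1
  rw [h2] at this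
  refine this.trans ?_
  exact congrArg (modelDeriv 𝓘(ℝ, E) 𝓘(ℝ, E) (fun q => γ t * q) 1) hX

/-- Conjugation by `p` corresponds to `Ad p` under the exponential map. -/
theorem lieExp_smul_lieAd (p : G) (X : GroupLieAlgebra 𝓘(ℝ, E) G) (t : ℝ) :
    (lieExp (t • (lieAd p X : E) : GroupLieAlgebra 𝓘(ℝ, E) G) : G) =
      p * lieExp (t • X) * p⁻¹ := by
  have hd : MDifferentiableAt 𝓘(ℝ, ℝ) 𝓘(ℝ, E) (fun t : ℝ => p * lieExp (t • X) * p⁻¹) 0 :=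
    MDifferentiableAt.comp (g := fun q => p * q * p⁻¹) 0 (mdifferentiable_conj (E := E) p _)
      (mdifferentiable_lieExp_smul X 0)
  refine (eq_lieExp_of_add hd (by simp [lieExp_zero]) (fun s t => ?_) ?_ t).symm
  · rw [lieExp_add_smul]; group
  · have := modelDeriv_comp_apply (y := (1 : G)) (mdifferentiable_conj (E := E) p _)
      (mdifferentiable_lieExp_smul X 0) (by simp [lieExp_zero]) 1
    rw [modelDeriv_lieExp_smul] at this
    exact this

theorem hasDerivAt_lieAd_lieExp (X : GroupLieAlgebra 𝓘(ℝ, E) G) (Z : E) (t : ℝ) :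
    HasDerivAt (fun s : ℝ => lieAd (lieExp (s • X) : G) Z)
      (lieAd (lieExp (t • X) : G) (lieBr G X Z)) t := by
  have := hasDerivAt_lieAd_curve (mdifferentiable_lieExp_smul X t) Z
  rwa [bodyVelocity_lieExp_smul] at this

/-- `lieBr` is the bracket of left-invariant vector fields: the flow of such a field is right
multiplication by `exp (s X)`, and the Lie derivative along it is the derivative of
`Ad (exp (s X))`. -/
theorem lieBr_eq_bracket (X Z : GroupLieAlgebra 𝓘(ℝ, E) G) :
    lieBr (E := E) G X Z = (⁅X, Z⁆ : GroupLieAlgebra 𝓘(ℝ, E) G) := by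
  have : CompleteSpace E := FiniteDimensional.complete ℝ E
  let e : ℝ → G := fun s => lieExp (s • X)
  have hΦ : ContMDiff (𝓘(ℝ, ℝ).prod 𝓘(ℝ, E)) 𝓘(ℝ, E) 2 (fun q : ℝ × G => q.2 * e q.1) :=
    contMDiff_snd.mul ((contMDiff_lieExp_smul X).comp contMDiff_fst)
  have h0 : e 0 = 1 := by simp [e, lieExp_zero]
  have hneg : ∀ s, e (-s) = (e s)⁻¹ := fun s => lieExp_neg_smul X s
  have hV : MDiffAt (T% (mulInvariantVectorField Z)) (1 : G) :=
    (contMDiff_mulInvariantVectorField_two Z).contMDiffAt.mdifferentiableAt (by norm_num)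
  have h1 := hasDerivAt_flow_pullback hΦ (by simp [h0]) (by simp [hneg])
    (K := mulInvariantVectorField X) (V := mulInvariantVectorField Z) (x := 1)
    (fun y => by
      have := modelDeriv_comp_apply (y := (1 : G)) (mdifferentiable_leftMul (E := E) y _)
        (mdifferentiable_lieExp_smul X 0) (by simp [lieExp_zero]) 1
      rw [modelDeriv_lieExp_smul] at this
      exact this.symm) hV
  have h2 := hasDerivAt_lieAd_lieExp X Z 0
  rw [zero_smul, lieExp_zero, lieAd_one] at h2
  refine (h1.unique (h2.congr_of_eventuallyEq (Filter.Eventually.of_forall fun s => ?_))).symm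
  have h3 := modelDeriv_comp_apply (y := 1 * e s) (mdifferentiable_rightMul (E := E) (e (-s)) _)
    (mdifferentiable_leftMul (E := E) (1 * e s) 1) (by simp) Z
  refine h3.symm.trans ?_
  simp only [hneg, one_mul]
  rfl

theorem lieBr_skew (X Z : E) : lieBr G X Z = -lieBr G Z X := by
  have : LieGroup 𝓘(ℝ, E) (minSmoothness ℝ 3) G := lieGroup_minSmoothness
  have : CompleteSpace E := FiniteDimensional.complete ℝ E
  let X' : GroupLieAlgebra 𝓘(ℝ, E) G := X
  let Z' : GroupLieAlgebra 𝓘(ℝ, E) G := Z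
  have h : ⁅X', Z'⁆ = -⁅Z', X'⁆ := (lie_skew X' Z').symm
  exact (lieBr_eq_bracket X' Z').trans (h.trans (congrArg Neg.neg (lieBr_eq_bracket Z' X').symm))

theorem lieBr_self (X : E) : lieBr G X X = 0 := by
  have : LieGroup 𝓘(ℝ, E) (minSmoothness ℝ 3) G := lieGroup_minSmoothness
  have : CompleteSpace E := FiniteDimensional.complete ℝ E
  let X' : GroupLieAlgebra 𝓘(ℝ, E) G := X
  exact (lieBr_eq_bracket X' X').trans (lie_self X')

theorem lieBr_add_right (X Y Z : E) : lieBr G X (Y + Z) = lieBr G X Y + lieBr G X Z := by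
  rw [lieBr_skew, lieBr_add_left, lieBr_skew X Y, lieBr_skew X Z]; abel

theorem lieBr_smul_right (a : ℝ) (X Z : E) : lieBr G X (a • Z) = a • lieBr G X Z := by
  rw [lieBr_skew, lieBr_smul_left, lieBr_skew X Z, smul_neg]

theorem lieAd_lieExp_of_lieBr_eq_zero (X : GroupLieAlgebra 𝓘(ℝ, E) G) {Z : E}
    (h : lieBr (E := E) G X Z = 0) (t : ℝ) : lieAd (lieExp (t • X) : G) Z = Z := by
  have h1 : ∀ s, HasDerivAt (fun s : ℝ => lieAd (lieExp (s • X) : G) Z) 0 s := fun s => by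
    have h2 := hasDerivAt_lieAd_lieExp X Z s
    rwa [h, map_zero] at h2
  have := is_const_of_deriv_eq_zero (fun s => (h1 s).differentiableAt) (fun s => (h1 s).deriv) t 0
  simpa [lieExp_zero, lieAd_one] using this

theorem hasDerivAt_lieAd_lieExp_clm (X : GroupLieAlgebra 𝓘(ℝ, E) G) (t : ℝ) :
    ∃ D : E →L[ℝ] E, (∀ Z, D Z = lieAd (lieExp (t • X) : G) (lieBr (E := E) G X Z)) ∧
      HasDerivAt (fun s : ℝ => (lieAd (lieExp (s • X) : G) : E →L[ℝ] E)) D t := by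
  have h1 : ContDiff ℝ 1 (fun s : ℝ => (lieAd (lieExp (s • X) : G) : E →L[ℝ] E)) := by
    refine contDiff_clm_apply_iff.2 fun Z => ?_
    rw [← contMDiff_iff_contDiff]
    exact ((contMDiff_lieAd Z).of_le (by norm_num)).comp
      ((contMDiff_lieExp_smul X).of_le (by norm_num))
  have h2 := (h1.differentiable (by norm_num) t).hasDerivAt
  refine ⟨_, fun Z => ?_, h2⟩
  have h3 := h2.clm_apply (hasDerivAt_const t Z)
  have h4 := h3.unique (hasDerivAt_lieAd_lieExp X Z t)
  simpa using h4

/-- If `ι` intertwines `A` with `ad X`, then it intertwines `exp (t A)` with `Ad (exp (t X))`. -/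
theorem lieAd_lieExp_intertwine {U : Type*} [NormedAddCommGroup U] [NormedSpace ℝ U]
    [CompleteSpace U] (X : GroupLieAlgebra 𝓘(ℝ, E) G) (ι : U →L[ℝ] E) (A : U →L[ℝ] U)
    (h : ∀ u, lieBr (E := E) G X (ι u) = ι (A u)) (u : U) (t : ℝ) :
    ∃ v, lieAd (lieExp (t • X) : G) (ι u) = ι v := by
  -- `Ad (exp (s X)) ∘ ι ∘ exp (-s A)` is constant in `s`.
  have hw : ∀ w s, HasDerivAt (fun s : ℝ => lieAd (lieExp (s • X) : G)
      (ι (NormedSpace.exp (s • (-A)) w))) 0 s := by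
    intro w s
    obtain ⟨D, hD, hDd⟩ := hasDerivAt_lieAd_lieExp_clm X s
    have h1 := (hasDerivAt_exp_smul_const' (𝕂 := ℝ) (-A) s).clm_apply (hasDerivAt_const s w)
    have h2 := ι.hasFDerivAt.comp_hasDerivAt s h1
    have h3 := hDd.clm_apply h2
    refine h3.congr_deriv ?_
    simp [hD, h]
  refine ⟨NormedSpace.exp (t • A) u, ?_⟩
  have hc := is_const_of_deriv_eq_zero (fun s => (hw (NormedSpace.exp (t • A) u) s).differentiableAt)
    (fun s => (hw _ s).deriv) t 0
  have he' : NormedSpace.exp (-(t • A)) * NormedSpace.exp (t • A) = 1 := by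
    let _ : NormedAlgebra ℚ (U →L[ℝ] U) := NormedAlgebra.restrictScalars ℚ ℝ _
    have hc : Commute (-(t • A)) (t • A) := (Commute.refl _).neg_left
    rw [← NormedSpace.exp_add_of_commute hc, neg_add_cancel, NormedSpace.exp_zero]
  have he : NormedSpace.exp (-(t • A)) (NormedSpace.exp (t • A) u) = u :=
    DFunLike.congr_fun he' u
  simpa [lieExp_zero, lieAd_one, he] using hc

/-- `Ad (exp (t X))` preserves each subspace which is preserved by `ad X`. -/
theorem lieAd_lieExp_mem (X : GroupLieAlgebra 𝓘(ℝ, E) G) {U : Submodule ℝ E}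
    (hU : ∀ Z ∈ U, lieBr (E := E) G X Z ∈ U) {Z : E} (hZ : Z ∈ U) (t : ℝ) :
    lieAd (lieExp (t • X) : G) Z ∈ U := by
  have : CompleteSpace U := FiniteDimensional.complete ℝ U
  let A : U →L[ℝ] U := LinearMap.toContinuousLinearMap
    { toFun := fun Z => ⟨lieBr G X Z, hU Z Z.2⟩
      map_add' := fun Y Z => Subtype.ext (lieBr_add_right _ _ _)
      map_smul' := fun a Z => Subtype.ext (lieBr_smul_right _ _ _) }
  obtain ⟨v, hv⟩ := lieAd_lieExp_intertwine X U.subtypeL A (fun _ => rfl) ⟨Z, hZ⟩ t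
  have hv' : lieAd (lieExp (t • X) : G) Z = v := hv
  rw [hv']
  exact v.2

theorem hasDerivAt_mem_submodule {U : Submodule ℝ E} {f : ℝ → E} {f' : E} {t : ℝ}
    (hf : HasDerivAt f f' t) (hU : ∀ s, f s ∈ U) : f' ∈ U := by
  have hcl : IsClosed (U : Set E) := U.closed_of_finiteDimensional
  refine hcl.mem_of_tendsto (hasDerivAt_iff_tendsto_slope.1 hf) (Filter.Eventually.of_forall ?_)
  intro s
  rw [slope_def_module]
  exact U.smul_mem _ (U.sub_mem (hU s) (hU t))

/-- The Lie algebra of a subgroup `K` is invariant under `Ad K`. -/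
theorem lieAd_mem_subgroupLieAlgebra {K : Subgroup G} {p : G} (hp : p ∈ K)
    {X : GroupLieAlgebra 𝓘(ℝ, E) G} (hX : X ∈ subgroupLieAlgebra K) :
    (lieAd p X : E) ∈ (subgroupLieAlgebra K : Submodule ℝ (GroupLieAlgebra 𝓘(ℝ, E) G)) := by
  induction hX using Submodule.span_induction with
  | mem X hX =>
    refine Submodule.subset_span fun t => ?_
    have h1 := lieExp_smul_lieAd p X t
    have h2 : p * lieExp (t • X) * p⁻¹ ∈ K := K.mul_mem (K.mul_mem hp (hX t)) (K.inv_mem hp)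
    rw [← h1] at h2
    exact h2
  | zero => exact (map_zero (lieAd (E := E) p)).symm ▸ Submodule.zero_mem _
  | add X Y _ _ hX hY => exact (map_add (lieAd (E := E) p) X Y).symm ▸ Submodule.add_mem _ hX hY
  | smul a X _ hX => exact (map_smul (lieAd (E := E) p) a X).symm ▸ Submodule.smul_mem _ a hX

theorem lieBr_mem_subgroupLieAlgebra {K : Subgroup G} {X Y : GroupLieAlgebra 𝓘(ℝ, E) G}
    (hX : X ∈ subgroupLieAlgebra K) (hY : Y ∈ subgroupLieAlgebra K) :
    (lieBr (E := E) G X Y) ∈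
      (subgroupLieAlgebra K : Submodule ℝ (GroupLieAlgebra 𝓘(ℝ, E) G)) := by
  let U : Submodule ℝ E := (subgroupLieAlgebra K : Submodule ℝ (GroupLieAlgebra 𝓘(ℝ, E) G))
  induction hX using Submodule.span_induction with
  | mem X hX =>
    have h1 := hasDerivAt_lieAd_lieExp X Y 0
    rw [zero_smul, lieExp_zero, lieAd_one] at h1
    exact hasDerivAt_mem_submodule (U := U) h1
      fun s => lieAd_mem_subgroupLieAlgebra (hX s) hY
  | zero =>
    have h0 : lieBr G (0 : E) Y = (0 : E) :=
      map_zero (modelDeriv 𝓘(ℝ, E) 𝓘(ℝ, E) (fun q : G => lieAd (E := E) q Y) 1)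
    have h1 : (lieBr G (0 : E) Y : E) ∈ U := by rw [h0]; exact U.zero_mem
    exact h1
  | add X Z _ _ hX hZ => exact (lieBr_add_left (E := E) (G := G) X Z Y).symm ▸ Submodule.add_mem U hX hZ
  | smul a X _ hX => exact (lieBr_smul_left (E := E) (G := G) a X Y).symm ▸ Submodule.smul_mem U a hX

end LieGroupBracket

section BiInvariant

variable {E : Type*} [NormedAddCommGroup E] [NormedSpace ℝ E]
  {G : Type*} [TopologicalSpace G] [ChartedSpace E G] [Group G] [LieGroup 𝓘(ℝ, E) ∞ G]
  {b : ContMDiffRiemannianMetric 𝓘(ℝ, E) ∞ E (fun x : G => TangentSpace 𝓘(ℝ, E) x)}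

/-- The inner product of a bi-invariant metric is `Ad`-invariant. -/
theorem IsBiInvariant.inner_lieAd (hb : IsBiInvariant b) (p : G) (u v : E) :
    b.inner 1 (lieAd (E := E) p u) (lieAd (E := E) p v) = b.inner 1 u v := by
  have h1 := hb.1 p 1 u v
  have h2 := hb.2 p⁻¹ (p * 1) (modelDeriv 𝓘(ℝ, E) 𝓘(ℝ, E) (fun y => p * y) 1 u)
    (modelDeriv 𝓘(ℝ, E) 𝓘(ℝ, E) (fun y => p * y) 1 v)
  have h3 : ∀ w : E, lieAd p w = modelDeriv 𝓘(ℝ, E) 𝓘(ℝ, E) (fun y => y * p⁻¹) (p * 1)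
      (modelDeriv 𝓘(ℝ, E) 𝓘(ℝ, E) (fun y => p * y) 1 w) := fun w =>
    modelDeriv_comp_apply (mdifferentiable_rightMul _ _) (mdifferentiable_leftMul _ _) rfl w
  rw [h3, h3]
  exact (metric_inner_congr b (by simp) _ _).trans (h2.trans h1)

/-- The endomorphisms `ad X` are skew-symmetric for a bi-invariant metric. -/
theorem IsBiInvariant.inner_lieBr [FiniteDimensional ℝ E] [T2Space G] (hb : IsBiInvariant b)
    (X u v : E) : b.inner 1 (lieBr (E := E) G X u) v =
      -b.inner 1 u (lieBr (E := E) G X v) := by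
  let B : E →L[ℝ] E →L[ℝ] ℝ := b.inner 1
  let X' : GroupLieAlgebra 𝓘(ℝ, E) G := X
  have h1 := hasDerivAt_lieAd_lieExp X' u 0
  have h2 := hasDerivAt_lieAd_lieExp X' v 0
  rw [zero_smul, lieExp_zero, lieAd_one] at h1 h2
  have h3 := (B.hasFDerivAt.comp_hasDerivAt (0 : ℝ) h1).clm_apply h2
  have h4 : HasDerivAt (fun s : ℝ => B (lieAd (lieExp (s • X') : G) u)
      (lieAd (lieExp (s • X') : G) v)) 0 0 := by
    have : (fun s : ℝ => B (lieAd (lieExp (s • X') : G) u) (lieAd (lieExp (s • X') : G) v)) =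
      fun _ => B u v := funext fun s => hb.inner_lieAd _ _ _
    rw [this]
    exact hasDerivAt_const _ _
  have h5 := h3.unique h4
  simp only [Function.comp_apply, zero_smul, lieExp_zero, lieAd_one,
    ContinuousLinearMap.id_apply] at h5
  exact eq_neg_of_add_eq_zero_left h5

end BiInvariant

/-! ### Local sections of a submersion; the action on the homogeneous space -/

section SubmersionSection

open Filter

variable {E : Type*} [NormedAddCommGroup E] [NormedSpace ℝ E]
  {F : Type*} [NormedAddCommGroup F] [NormedSpace ℝ F]
  {M : Type*} [TopologicalSpace M] [ChartedSpace E M]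
  {N : Type*} [TopologicalSpace N] [ChartedSpace F N]

/-- A submersion has a smooth local section through each point. -/
theorem exists_local_section {f : M → N} {x : M}
    (h : IsSubmersionAt 𝓘(ℝ, E) 𝓘(ℝ, F) ∞ f x) :
    ∃ σ : N → M, σ (f x) = x ∧ (∀ᶠ y in 𝓝 (f x), ContMDiffAt 𝓘(ℝ, F) 𝓘(ℝ, E) ∞ σ y) ∧
      ∀ᶠ y in 𝓝 (f x), f (σ y) = y := by
  let D := h.domChart.extend 𝓘(ℝ, E)
  let C := h.codChart.extend 𝓘(ℝ, F)
  have hDx : D x ∈ D.target := D.map_source (by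
    rw [OpenPartialHomeomorph.extend_source]; exact h.mem_domChart_source)
  have hDs : D.symm (D x) = x := D.left_inv (by
    rw [OpenPartialHomeomorph.extend_source]; exact h.mem_domChart_source)
  -- In the charts, `f` is a linear projection; keep the complementary coordinate constant.
  let a : N → E := fun y => h.equiv.symm (C y, (h.equiv (D x)).2)
  have hCf : C (f x) = (h.equiv (D x)).1 := by
    have h1 : C (f (D.symm (D x))) = (h.equiv (D x)).1 := h.writtenInCharts hDx
    rwa [hDs] at h1
  have ha : a (f x) = D x := by
    simp only [a, hCf, Prod.mk.eta, ContinuousLinearEquiv.symm_apply_apply]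
  have hs : ∀ᶠ y in 𝓝 (f x), y ∈ h.codChart.source :=
    h.codChart.open_source.mem_nhds h.mem_codChart_source
  have hCsm : ∀ y ∈ h.codChart.source, ContMDiffAt 𝓘(ℝ, F) 𝓘(ℝ, F) ∞ C y := fun y hy =>
    h.codChart.contMDiffAt_extend h.codChart_mem_maximalAtlas hy
  have hasm : ∀ y ∈ h.codChart.source, ContMDiffAt 𝓘(ℝ, F) 𝓘(ℝ, E) ∞ a y := fun y hy =>
    (h.equiv.symm.contDiff.contMDiff.contMDiffAt).comp y
      ((hCsm y hy).prodMk_space contMDiffAt_const)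
  have hDo : IsOpen D.target := h.domChart.isOpen_extend_target
  have hD : ∀ᶠ y in 𝓝 (f x), a y ∈ D.target :=
    (hasm _ h.mem_codChart_source).continuousAt.eventually_mem (hDo.mem_nhds (ha ▸ hDx))
  refine ⟨fun y => D.symm (a y), (congrArg D.symm ha).trans hDs, ?_, ?_⟩
  · filter_upwards [hs, hD] with y hy hyD
    have h1 : ContMDiffAt 𝓘(ℝ, E) 𝓘(ℝ, E) ∞ D.symm (a y) := by
      have h2 := contMDiffOn_extend_symm (I := 𝓘(ℝ, E)) h.domChart_mem_maximalAtlas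
      refine h2.contMDiffAt (Filter.mem_of_superset (hDo.mem_nhds hyD) ?_)
      rw [← OpenPartialHomeomorph.extend_target']
    exact h1.comp y (hasm y hy)
  · filter_upwards [hs, hD] with y hy hyD
    have h1 : C (f (D.symm (a y))) = (h.equiv (a y)).1 := h.writtenInCharts hyD
    have h2 : (h.equiv (a y)).1 = C y := by simp [a]
    refine C.injOn ?_ ?_ (h1.trans h2)
    · rw [OpenPartialHomeomorph.extend_source]
      refine h.source_subset_preimage_source ?_
      have := D.map_target hyD
      rwa [OpenPartialHomeomorph.extend_source] at this
    · rw [OpenPartialHomeomorph.extend_source]; exact hy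

/-- The differential of a submersion is surjective. -/
theorem modelDeriv_surjective {f : M → N} {x : M}
    (h : IsSubmersionAt 𝓘(ℝ, E) 𝓘(ℝ, F) ∞ f x) :
    Function.Surjective (modelDeriv 𝓘(ℝ, E) 𝓘(ℝ, F) f x) := by
  obtain ⟨σ, hσx, hσ, hfσ⟩ := exists_local_section h
  intro v
  refine ⟨modelDeriv 𝓘(ℝ, F) 𝓘(ℝ, E) σ (f x) v, ?_⟩
  rw [← modelDeriv_comp_apply (h.contMDiffAt.mdifferentiableAt (by simp))
    (hσ.self_of_nhds.mdifferentiableAt (by simp)) hσx]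
  rw [modelDeriv_congr (f' := fun z => z) hfσ, modelDeriv_id]
  rfl

end SubmersionSection

section Homogeneous

open Filter

variable {E : Type*} [NormedAddCommGroup E] [NormedSpace ℝ E]
  {F : Type*} [NormedAddCommGroup F] [NormedSpace ℝ F]
  {G : Type*} [TopologicalSpace G] [ChartedSpace E G] [Group G]
  {H : Subgroup G} [ChartedSpace F (G ⧸ H)]

variable (E F H) in
/-- The differential at the identity of `q ↦ (p q) H`: the identification of `𝔤 / 𝔥` with the
tangent space of `G/H` at `p H` which is given by the left translation by `p`. -/
def leftProj (p : G) : E →L[ℝ] F :=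
  modelDeriv 𝓘(ℝ, E) 𝓘(ℝ, F) (fun q : G => ((p * q : G) : G ⧸ H)) 1

variable [LieGroup 𝓘(ℝ, E) ∞ G]
  (hproj : IsSubmersion 𝓘(ℝ, E) 𝓘(ℝ, F) ∞ (fun p : G => (p : G ⧸ H)))

include hproj

omit [LieGroup 𝓘(ℝ, E) ∞ G] in
theorem mdifferentiable_proj : MDifferentiable 𝓘(ℝ, E) 𝓘(ℝ, F) (fun p : G => (p : G ⧸ H)) :=
  hproj.contMDiff.mdifferentiable (by simp)

theorem leftProj_eq (p : G) (v : E) :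
    leftProj E F H p v = modelDeriv 𝓘(ℝ, E) 𝓘(ℝ, F) (fun p : G => (p : G ⧸ H)) p
      (modelDeriv 𝓘(ℝ, E) 𝓘(ℝ, E) (fun q => p * q) 1 v) :=
  modelDeriv_comp_apply (mdifferentiable_proj hproj p) (mdifferentiable_leftMul p 1) (mul_one p) v

theorem leftProj_surjective (p : G) : Function.Surjective (leftProj E F H p) := by
  intro v
  obtain ⟨u, hu⟩ := modelDeriv_surjective (hproj.isSubmersionAt p) v
  refine ⟨modelDeriv 𝓘(ℝ, E) 𝓘(ℝ, E) (fun q => p⁻¹ * q) p u, ?_⟩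
  rw [leftProj_eq hproj, ← modelDeriv_comp_apply (mdifferentiable_leftMul p 1)
    (mdifferentiable_leftMul p⁻¹ p) (by simp)]
  simpa [modelDeriv_id] using hu

theorem modelDeriv_proj_curve {p : ℝ → G} {t : ℝ} (hp : MDifferentiableAt 𝓘(ℝ, ℝ) 𝓘(ℝ, E) p t) :
    modelDeriv 𝓘(ℝ, ℝ) 𝓘(ℝ, F) (fun s => (p s : G ⧸ H)) t 1 =
      leftProj E F H (p t) (bodyVelocity p t) :=
  modelDeriv_comp_curve (mdifferentiable_proj hproj _) hp

/-- A smooth family of elements of `G` acts smoothly on `G/H`. -/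
theorem contMDiff_smul_quotient {E' H' N : Type*} [NormedAddCommGroup E'] [NormedSpace ℝ E']
    [TopologicalSpace H'] {I' : ModelWithCorners ℝ E' H'} [TopologicalSpace N] [ChartedSpace H' N]
    {n : WithTop ℕ∞} (hn : n ≤ ∞) {a : N → G} (ha : ContMDiff I' 𝓘(ℝ, E) n a) :
    ContMDiff (I'.prod 𝓘(ℝ, F)) 𝓘(ℝ, F) n (fun x : N × (G ⧸ H) => a x.1 • x.2) := by
  have : LieGroup 𝓘(ℝ, E) n G := LieGroup.of_le hn
  rintro ⟨s, y⟩
  obtain ⟨p, rfl⟩ := QuotientGroup.mk_surjective y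
  obtain ⟨σ, hσp, hσ, hπσ⟩ := exists_local_section (hproj.isSubmersionAt p)
  have h1 : ContMDiffAt (I'.prod 𝓘(ℝ, F)) 𝓘(ℝ, E) n (fun x : N × (G ⧸ H) => a x.1 * σ x.2)
      (s, (p : G ⧸ H)) :=
    (ha.contMDiffAt.comp (s, (p : G ⧸ H)) contMDiffAt_fst).mul
      ((hσ.self_of_nhds.of_le hn).comp (s, (p : G ⧸ H)) contMDiffAt_snd)
  have h2 := ((hproj.contMDiff.of_le hn).contMDiffAt (x := a s * σ p)).comp (s, (p : G ⧸ H)) h1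
  refine h2.congr_of_eventuallyEq ?_
  have h3 : Tendsto Prod.snd (𝓝 (s, (p : G ⧸ H))) (𝓝 (p : G ⧸ H)) := continuous_snd.continuousAt
  filter_upwards [h3.eventually hπσ] with x hx
  have h4 : ((a x.1 * σ x.2 : G) : G ⧸ H) = a x.1 • ((σ x.2 : G) : G ⧸ H) := rfl
  exact ((h4.trans (congrArg (a x.1 • ·) hx))).symm

theorem contMDiff_translation (p : G) :
    ContMDiff 𝓘(ℝ, F) 𝓘(ℝ, F) ∞ (fun y : G ⧸ H => p • y) :=
  (contMDiff_smul_quotient hproj (le_refl _)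
    (contMDiff_const (I := 𝓘(ℝ, ℝ)) (M := ℝ) (c := p))).comp
    ((contMDiff_const (c := (0 : ℝ))).prodMk contMDiff_id)

theorem translationDeriv_projDeriv (p : G) (v : GroupLieAlgebra 𝓘(ℝ, E) G) :
    (translationDeriv p ((1 : G) : G ⧸ H) (projDeriv H v) : F) = leftProj E F H p v :=
  (modelDeriv_comp_apply (y := ((1 : G) : G ⧸ H))
    ((contMDiff_translation hproj p).mdifferentiable (by simp) _)
    (mdifferentiable_proj hproj 1) rfl v).symm

/-- The fundamental vector field of `Z` in terms of the adjoint representation. -/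
theorem modelDeriv_lieExp_smul_quotient [FiniteDimensional ℝ E] [T2Space G]
    (Z : GroupLieAlgebra 𝓘(ℝ, E) G) (p : G) :
    modelDeriv 𝓘(ℝ, ℝ) 𝓘(ℝ, F) (fun s : ℝ => (lieExp (s • Z) : G) • (p : G ⧸ H)) 0 1 =
      leftProj E F H p (lieAd p⁻¹ Z) := by
  have hd : MDifferentiableAt 𝓘(ℝ, ℝ) 𝓘(ℝ, E) (fun s : ℝ => (lieExp (s • Z) : G) * p) 0 :=
    MDifferentiableAt.comp (0 : ℝ) (mdifferentiable_rightMul (E := E) p _)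
      (mdifferentiable_lieExp_smul Z 0)
  have h1 := modelDeriv_proj_curve hproj hd
  refine h1.trans ?_
  have h2 : bodyVelocity (E := E) (fun s : ℝ => (lieExp (s • Z) : G) * p) 0 = lieAd (E := E) p⁻¹ Z := by
    have h3 := modelDeriv_lieExp_smul (G := G) (lieAd (E := E) p⁻¹ Z : E)
    refine Eq.trans ?_ h3
    refine congrArg (fun c : ℝ → G => modelDeriv 𝓘(ℝ, ℝ) 𝓘(ℝ, E) c 0 1) (funext fun s => ?_)
    have h4 := lieExp_smul_lieAd p⁻¹ Z s
    refine Eq.trans ?_ h4.symm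
    simp [lieExp_zero, mul_assoc]
  rw [h2]
  simp [lieExp_zero]

theorem leftProj_one (v : GroupLieAlgebra 𝓘(ℝ, E) G) : leftProj E F H 1 v = projDeriv H v := by
  have h := leftProj_eq hproj 1 (v : E)
  simp only [one_mul, modelDeriv_id] at h
  exact h

end Homogeneous

/-! ### The invariant metric and tensor in terms of the bi-invariant inner product -/

section BilinearForm

variable {V : Type*} [NormedAddCommGroup V] [NormedSpace ℝ V] [FiniteDimensional ℝ V]

/-- A bilinear form which is positive definite on `U` identifies `U` with its dual space. -/
theorem exists_repr_of_pos {B : V →L[ℝ] V →L[ℝ] ℝ} (hpos : ∀ v, v ≠ 0 → 0 < B v v)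
    (U : Submodule ℝ V) (f : V →ₗ[ℝ] ℝ) : ∃ u ∈ U, ∀ w ∈ U, B u w = f w := by
  let φ : U →ₗ[ℝ] Module.Dual ℝ U :=
    { toFun := fun u => (B u : V →ₗ[ℝ] ℝ) ∘ₗ U.subtype
      map_add' := fun u v => by ext; simp
      map_smul' := fun a u => by ext; simp }
  have hinj : Function.Injective φ := by
    rw [← LinearMap.ker_eq_bot, LinearMap.ker_eq_bot']
    intro u hu
    by_contra hne
    have h1 := hpos u (by simpa using hne)
    have h2 : B u u = 0 := congrArg (fun l : Module.Dual ℝ U => l u) hu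
    exact h1.ne' h2
  obtain ⟨u, hu⟩ := (LinearMap.injective_iff_surjective_of_finrank_eq_finrank
    Subspace.dual_finrank_eq.symm).1 hinj (f ∘ₗ U.subtype)
  exact ⟨u, u.2, fun w hw => congrArg (fun l : Module.Dual ℝ U => l ⟨w, hw⟩) hu⟩

/-- Orthogonal projection onto a subspace. -/
theorem exists_sub_mem_orthComplement {B : V →L[ℝ] V →L[ℝ] ℝ} (hpos : ∀ v, v ≠ 0 → 0 < B v v)
    (hsymm : ∀ u v, B u v = B v u) (U : Submodule ℝ V) (v : V) :
    ∃ u ∈ U, v - u ∈ orthComplement B U := by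
  obtain ⟨u, hu, h⟩ := exists_repr_of_pos hpos U (B v)
  refine ⟨u, hu, fun w hw => ?_⟩
  rw [map_sub, hsymm w u, h w hw, hsymm w v]
  exact sub_self _

/-- Each bilinear form is represented by an endomorphism with respect to a positive definite one. -/
theorem exists_endomorphism_repr {B : V →L[ℝ] V →L[ℝ] ℝ} (hpos : ∀ v, v ≠ 0 → 0 < B v v)
    (Q : V →L[ℝ] V →L[ℝ] ℝ) : ∃ S : V →L[ℝ] V, ∀ u v, Q u v = B (S u) v := by
  have hB : ∀ u, (∀ v, B u v = 0) → u = 0 := fun u h => by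
    by_contra hne
    exact (hpos u hne).ne' (h u)
  choose S hS using fun u => exists_repr_of_pos hpos ⊤ (Q u : V →ₗ[ℝ] ℝ)
  have hS' : ∀ u v, B (S u) v = Q u v := fun u v => (hS u).2 v trivial
  refine ⟨LinearMap.toContinuousLinearMap
    { toFun := S
      map_add' := fun u v => sub_eq_zero.1 (hB _ fun w => ?_)
      map_smul' := fun a u => sub_eq_zero.1 (hB _ fun w => ?_) }, fun u v => (hS' u v).symm⟩
  · simp [hS']
  · simp [hS']

/-- An endomorphism `R` which recovers the class of `v` modulo the kernel of `S` from `S v`. -/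
theorem exists_generalized_inverse (S : V →L[ℝ] V) :
    ∃ R : V →L[ℝ] V, ∀ v, S (R (S v)) = S v := by
  obtain ⟨f, hf⟩ := (S : V →ₗ[ℝ] V).rangeRestrict.exists_rightInverse_of_surjective
    (LinearMap.range_rangeRestrict _)
  obtain ⟨R, hR⟩ := f.exists_extend
  refine ⟨LinearMap.toContinuousLinearMap R, fun v => ?_⟩
  let w : LinearMap.range (S : V →ₗ[ℝ] V) := ⟨S v, v, rfl⟩
  have h1 : R (S v) = f w := DFunLike.congr_fun hR w
  have h2 := DFunLike.congr_fun hf w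
  have h3 : S (f w) = S v := congrArg Subtype.val h2
  exact (congrArg S h1).trans h3

end BilinearForm

section InvariantMetric

variable {E : Type*} [NormedAddCommGroup E] [NormedSpace ℝ E]
  {F : Type*} [NormedAddCommGroup F] [NormedSpace ℝ F]
  {G : Type*} [TopologicalSpace G] [ChartedSpace E G] [Group G] [LieGroup 𝓘(ℝ, E) ∞ G]
  {H : Subgroup G} [ChartedSpace F (G ⧸ H)] [IsManifold 𝓘(ℝ, F) ∞ (G ⧸ H)]
  (hproj : IsSubmersion 𝓘(ℝ, E) 𝓘(ℝ, F) ∞ (fun p : G => (p : G ⧸ H)))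

include hproj

theorem IsInvariantMetric.inner_leftProj
    {g : ContMDiffRiemannianMetric 𝓘(ℝ, F) ∞ F (fun x : G ⧸ H => TangentSpace 𝓘(ℝ, F) x)}
    (hg : IsInvariantMetric g) (p : G) (u v : GroupLieAlgebra 𝓘(ℝ, E) G) :
    g.inner (p : G ⧸ H) (leftProj E F H p u) (leftProj E F H p v) =
      g.inner ((1 : G) : G ⧸ H) (projDeriv H u) (projDeriv H v) := by
  have h1 := hg p ((1 : G) : G ⧸ H) (projDeriv H u) (projDeriv H v)
  rw [← h1]
  have h2 : p • ((1 : G) : G ⧸ H) = (p : G ⧸ H) := congrArg _ (mul_one p)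
  have h3 := metric_inner_congr g h2 (leftProj E F H p u) (leftProj E F H p v)
  refine h3.symm.trans ?_
  rw [← translationDeriv_projDeriv hproj, ← translationDeriv_projDeriv hproj]

omit [LieGroup 𝓘(ℝ, E) ∞ G] [IsManifold 𝓘(ℝ, F) ∞ (G ⧸ H)] hproj in
theorem tensor_congr {J : ∀ x : G ⧸ H, TangentSpace 𝓘(ℝ, F) x →L[ℝ] TangentSpace 𝓘(ℝ, F) x}
    {x y : G ⧸ H} (h : x = y) (v : F) : (J x v : F) = J y v := by subst h; rfl

omit [IsManifold 𝓘(ℝ, F) ∞ (G ⧸ H)] in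
theorem IsInvariantTensor.apply_leftProj
    {J : ∀ x : G ⧸ H, TangentSpace 𝓘(ℝ, F) x →L[ℝ] TangentSpace 𝓘(ℝ, F) x}
    (hJ : IsInvariantTensor J) (p : G) {u v : GroupLieAlgebra 𝓘(ℝ, E) G}
    (huv : J ((1 : G) : G ⧸ H) (projDeriv H u) = projDeriv H v) :
    (J (p : G ⧸ H) (leftProj E F H p u) : F) = leftProj E F H p v := by
  have h1 := hJ p ((1 : G) : G ⧸ H) (projDeriv H u)
  rw [huv] at h1
  have h2 : p • ((1 : G) : G ⧸ H) = (p : G ⧸ H) := congrArg _ (mul_one p)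
  rw [← translationDeriv_projDeriv hproj, ← translationDeriv_projDeriv hproj]
  exact (tensor_congr h2.symm _).trans h1

variable [FiniteDimensional ℝ E] [T2Space G]

omit [IsManifold 𝓘(ℝ, F) ∞ (G ⧸ H)] in
/-- The differential of the projection vanishes on the Lie algebra of `H`. -/
theorem projDeriv_eq_zero {X : GroupLieAlgebra 𝓘(ℝ, E) G} (hX : X ∈ subgroupLieAlgebra H) :
    projDeriv (F := F) H X = 0 := by
  induction hX using Submodule.span_induction with
  | mem X hX =>
    have h1 := modelDeriv_proj_curve hproj (mdifferentiable_lieExp_smul X 0)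
    rw [bodyVelocity_lieExp_smul, zero_smul, lieExp_zero] at h1
    have h2 : (fun s : ℝ => ((lieExp (s • X) : G) : G ⧸ H)) = fun _ => ((1 : G) : G ⧸ H) :=
      funext fun s => (QuotientGroup.eq.2 (by simpa using hX s)).symm
    rw [h2, modelDeriv_const] at h1
    exact ((leftProj_one hproj X).symm.trans h1.symm)
  | zero => exact map_zero _
  | add X Y _ _ hX hY => rw [map_add, hX, hY, add_zero]
  | smul a X _ hX => rw [map_smul, hX, smul_zero]

variable {b : ContMDiffRiemannianMetric 𝓘(ℝ, E) ∞ E (fun x : G => TangentSpace 𝓘(ℝ, E) x)}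

omit hproj in
theorem IsBiInvariant.lieBr_mem_orthComplement (hb : IsBiInvariant b)
    {𝔲 : Submodule ℝ (GroupLieAlgebra 𝓘(ℝ, E) G)} {X Y : GroupLieAlgebra 𝓘(ℝ, E) G}
    (hX : ∀ Z ∈ 𝔲, lieBr (E := E) G X Z ∈ 𝔲) (hY : Y ∈ orthComplement (b.inner 1) 𝔲) :
    lieBr (E := E) G X Y ∈ orthComplement (b.inner 1) 𝔲 := by
  intro Z hZ
  have h1 := hb.inner_lieBr X Z Y
  have h2 : b.inner 1 (lieBr (E := E) G X Z) Y = 0 := hY _ (hX Z hZ)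
  exact neg_eq_zero.1 (h1.symm.trans h2)

omit hproj in
theorem subgroupLieAlgebra_mono {H K : Subgroup G} (h : H ≤ K) :
    (subgroupLieAlgebra H : Submodule ℝ (GroupLieAlgebra 𝓘(ℝ, E) G)) ≤ subgroupLieAlgebra K :=
  Submodule.span_mono fun _ hX t => h (hX t)

omit hproj in
/-- The orthogonal decomposition `𝔤 = 𝔥 ⊕ 𝔪₁ ⊕ 𝔪₂`. -/
theorem exists_add_orthComplement {K : Subgroup G} (hHK : H ≤ K) (v : E) :
    ∃ v₀ ∈ (subgroupLieAlgebra H : Submodule ℝ (GroupLieAlgebra 𝓘(ℝ, E) G)),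
    ∃ v₁ ∈ orthComplement (b.inner 1) (subgroupLieAlgebra K),
    ∃ v₂ ∈ subgroupLieAlgebra K ⊓ orthComplement (b.inner 1) (subgroupLieAlgebra H),
      v = (v₀ + (v₁ + v₂) : E) := by
  let B : E →L[ℝ] E →L[ℝ] ℝ := b.inner 1
  have hpos : ∀ v : E, v ≠ 0 → 0 < B v v := b.pos 1
  have hsymm : ∀ u v : E, B u v = B v u := b.symm 1
  obtain ⟨w, hw, hw'⟩ := exists_sub_mem_orthComplement hpos hsymm
    (subgroupLieAlgebra K : Submodule ℝ (GroupLieAlgebra 𝓘(ℝ, E) G)) v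
  obtain ⟨v₀, hv₀, hv₀'⟩ := exists_sub_mem_orthComplement hpos hsymm
    (subgroupLieAlgebra H : Submodule ℝ (GroupLieAlgebra 𝓘(ℝ, E) G)) w
  refine ⟨v₀, hv₀, v - w, hw', w - v₀, ⟨Submodule.sub_mem _ hw ?_, hv₀'⟩, by abel⟩
  exact subgroupLieAlgebra_mono hHK hv₀

/-- The metric `g_λ` and the tensor `I^W` in terms of the bi-invariant inner product: there is an
endomorphism `S` with `g_λ = B (S ·, ·)`, which is `1` on `𝔪₁`, `λ` on `𝔪₂` and vanishes on `𝔥`. -/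
theorem exists_metric_endomorphism (hb : IsBiInvariant b) {K : Subgroup G} (hHK : H ≤ K)
    {𝔪₁ 𝔪₂ : Submodule ℝ (GroupLieAlgebra 𝓘(ℝ, E) G)}
    (h𝔪₁ : 𝔪₁ = orthComplement (b.inner 1) (subgroupLieAlgebra K))
    (h𝔪₂ : 𝔪₂ = subgroupLieAlgebra K ⊓ orthComplement (b.inner 1) (subgroupLieAlgebra H))
    {lam : ℝ} (hlam : 0 < lam)
    {g : ContMDiffRiemannianMetric 𝓘(ℝ, F) ∞ F (fun x : G ⧸ H => TangentSpace 𝓘(ℝ, F) x)}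
    (hginv : IsInvariantMetric g)
    (hgo : ∀ X₁ ∈ 𝔪₁, ∀ X₂ ∈ 𝔪₂, ∀ Y₁ ∈ 𝔪₁, ∀ Y₂ ∈ 𝔪₂,
      g.inner ((1 : G) : G ⧸ H) (projDeriv H (X₁ + X₂)) (projDeriv H (Y₁ + Y₂)) =
        b.inner 1 X₁ Y₁ + lam * b.inner 1 X₂ Y₂)
    {W : GroupLieAlgebra 𝓘(ℝ, E) G} (hW : W ∈ lieCentre (subgroupLieAlgebra H))
    {J : ∀ x : G ⧸ H, TangentSpace 𝓘(ℝ, F) x →L[ℝ] TangentSpace 𝓘(ℝ, F) x}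
    (hJinv : IsInvariantTensor J)
    (hJo : ∀ X₁ ∈ 𝔪₁, ∀ X₂ ∈ 𝔪₂,
      J ((1 : G) : G ⧸ H) (projDeriv H (X₁ + X₂)) =
        projDeriv H (⁅W, X₁⁆ + (1 / lam) • ⁅W, X₂⁆)) :
    ∃ S : E →L[ℝ] E,
      (∀ (p : G) (u v : E), g.inner (p : G ⧸ H) (leftProj E F H p u) (leftProj E F H p v) =
        b.inner 1 (S u) v) ∧
      (∀ X ∈ 𝔪₁, S X = X) ∧ (∀ X ∈ 𝔪₂, S X = lam • X) ∧ S W = 0 ∧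
      ∀ (p : G) (u v : E), g.inner (p : G ⧸ H) (J p (leftProj E F H p u)) (leftProj E F H p v) =
        b.inner 1 (lieBr (E := E) G W u) v := by
  let B : E →L[ℝ] E →L[ℝ] ℝ := b.inner 1
  let P : E →L[ℝ] F := projDeriv (E := E) H
  let g₀ : F →L[ℝ] F →L[ℝ] ℝ := g.inner ((1 : G) : G ⧸ H)
  have hpos : ∀ v : E, v ≠ 0 → 0 < B v v := b.pos 1
  have hsymm : ∀ u v : E, B u v = B v u := b.symm 1
  obtain ⟨S, hS⟩ := exists_endomorphism_repr hpos (g₀.bilinearComp P P)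
  have hS' : ∀ u v : E, g₀ (P u) (P v) = B (S u) v := hS
  have hnd : ∀ u w : E, (∀ v, B u v = B w v) → u = w := fun u w h => by
    by_contra hne
    have := hpos (u - w) (sub_ne_zero.2 hne)
    rw [map_sub] at this
    simp [h] at this
  have hPH : ∀ v : E, v ∈ (subgroupLieAlgebra H : Submodule ℝ (GroupLieAlgebra 𝓘(ℝ, E) G)) →
    P v = 0 := fun v hv => projDeriv_eq_zero hproj hv
  have hle := subgroupLieAlgebra_mono (E := E) hHK
  have hdec : ∀ v : E, ∃ v₀ v₁ v₂ : E,
      v₀ ∈ (subgroupLieAlgebra H : Submodule ℝ (GroupLieAlgebra 𝓘(ℝ, E) G)) ∧ v₁ ∈ 𝔪₁ ∧ v₂ ∈ 𝔪₂ ∧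
      v = v₀ + (v₁ + v₂) := fun v => by
    obtain ⟨v₀, h₀, v₁, h₁, v₂, h₂, h⟩ := exists_add_orthComplement (b := b) hHK v
    exact ⟨v₀, v₁, v₂, h₀, h𝔪₁ ▸ h₁, h𝔪₂ ▸ h₂, h⟩
  have hgo' : ∀ X₁ X₂ Y₁ Y₂ : E, X₁ ∈ 𝔪₁ → X₂ ∈ 𝔪₂ → Y₁ ∈ 𝔪₁ → Y₂ ∈ 𝔪₂ →
      g₀ (P (X₁ + X₂)) (P (Y₁ + Y₂)) = B X₁ Y₁ + lam * B X₂ Y₂ :=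
    fun X₁ X₂ Y₁ Y₂ h₁ h₂ h₃ h₄ => hgo X₁ h₁ X₂ h₂ Y₁ h₃ Y₂ h₄
  -- the orthogonality relations between the three summands
  have ho : ∀ X Y : E, X ∈ (subgroupLieAlgebra K : Submodule ℝ (GroupLieAlgebra 𝓘(ℝ, E) G)) →
      Y ∈ 𝔪₁ → B X Y = 0 := fun X Y hX hY => by
    rw [h𝔪₁] at hY; exact hY X hX
  have ho' : ∀ X Y : E, X ∈ (subgroupLieAlgebra H : Submodule ℝ (GroupLieAlgebra 𝓘(ℝ, E) G)) →
      Y ∈ 𝔪₂ → B X Y = 0 := fun X Y hX hY => by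
    rw [h𝔪₂] at hY; exact hY.2 X hX
  have hK₂ : ∀ Y : E, Y ∈ 𝔪₂ →
      Y ∈ (subgroupLieAlgebra K : Submodule ℝ (GroupLieAlgebra 𝓘(ℝ, E) G)) := fun Y hY => by
    rw [h𝔪₂] at hY; exact hY.1
  have hS₁ : ∀ X : E, X ∈ 𝔪₁ → S X = X := fun X hX => hnd _ _ fun v => by
    obtain ⟨v₀, v₁, v₂, h₀, h₁, h₂, rfl⟩ := hdec v
    have h := hgo' X 0 v₁ v₂ hX (Submodule.zero_mem 𝔪₂) h₁ h₂
    rw [← hS', map_add P v₀, hPH v₀ h₀, zero_add]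
    rw [add_zero] at h
    rw [h, map_add, map_add, hsymm X v₀, hsymm X v₂, ho v₀ X (hle h₀) hX, ho v₂ X (hK₂ v₂ h₂) hX]
    simp
  have hS₂ : ∀ X : E, X ∈ 𝔪₂ → S X = lam • X := fun X hX => hnd _ _ fun v => by
    obtain ⟨v₀, v₁, v₂, h₀, h₁, h₂, rfl⟩ := hdec v
    have h := hgo' 0 X v₁ v₂ (Submodule.zero_mem 𝔪₁) hX h₁ h₂
    rw [← hS', map_add P v₀, hPH v₀ h₀, zero_add]
    rw [zero_add] at h
    have h3 : B X v₀ = 0 := (hsymm X v₀).trans (ho' v₀ X h₀ hX)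
    rw [h]
    simp [h3, ho X v₁ (hK₂ X hX) h₁]
  have hSW : S W = 0 := hnd _ _ fun v => by
    have h1 : B (S W) v = g₀ (P W) (P v) := (hS' W v).symm
    have h2 : P W = 0 := hPH W hW.1
    refine h1.trans ?_
    rw [h2]
    simp
  -- `ad W` preserves the three summands and vanishes on `𝔥`
  have hWK : ∀ Z ∈ (subgroupLieAlgebra K : Submodule ℝ (GroupLieAlgebra 𝓘(ℝ, E) G)),
      lieBr (E := E) G W Z ∈ (subgroupLieAlgebra K : Submodule ℝ (GroupLieAlgebra 𝓘(ℝ, E) G)) :=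
    fun Z hZ => lieBr_mem_subgroupLieAlgebra (hle hW.1) hZ
  have hWH : ∀ Z ∈ (subgroupLieAlgebra H : Submodule ℝ (GroupLieAlgebra 𝓘(ℝ, E) G)),
      lieBr (E := E) G W Z ∈ (subgroupLieAlgebra H : Submodule ℝ (GroupLieAlgebra 𝓘(ℝ, E) G)) :=
    fun Z hZ => lieBr_mem_subgroupLieAlgebra hW.1 hZ
  have hW₀ : ∀ Z : E, Z ∈ (subgroupLieAlgebra H : Submodule ℝ (GroupLieAlgebra 𝓘(ℝ, E) G)) →
      lieBr (E := E) G W Z = (0 : E) := fun Z hZ => (lieBr_eq_bracket W Z).trans (hW.2 Z hZ)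
  have hW₁ : ∀ Z : E, Z ∈ 𝔪₁ → lieBr (E := E) G W Z ∈ 𝔪₁ := fun Z hZ => by
    rw [h𝔪₁] at hZ ⊢
    exact hb.lieBr_mem_orthComplement hWK hZ
  have hW₂ : ∀ Z : E, Z ∈ 𝔪₂ → lieBr (E := E) G W Z ∈ 𝔪₂ := fun Z hZ => by
    rw [h𝔪₂] at hZ ⊢
    exact ⟨hWK Z hZ.1, hb.lieBr_mem_orthComplement hWH hZ.2⟩
  have hgp : ∀ (p : G) (u v : E),
      g.inner (p : G ⧸ H) (leftProj E F H p u) (leftProj E F H p v) = B (S u) v := fun p u v =>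
    (hginv.inner_leftProj hproj p u v).trans (hS' u v)
  refine ⟨S, hgp, hS₁, hS₂, hSW, fun p u v => ?_⟩
  obtain ⟨u₀, u₁, u₂, h₀, h₁, h₂, rfl⟩ := hdec u
  have hP : P (u₀ + (u₁ + u₂)) = P (u₁ + u₂) := by
    rw [map_add P u₀, hPH u₀ h₀, zero_add]
  have hJP : J ((1 : G) : G ⧸ H) (P (u₀ + (u₁ + u₂))) =
      P (lieBr (E := E) G W u₁ + (1 / lam) • lieBr (E := E) G W u₂) := by
    rw [hP, lieBr_eq_bracket W u₁, lieBr_eq_bracket W u₂]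
    exact hJo u₁ h₁ u₂ h₂
  have h3 := hJinv.apply_leftProj hproj p hJP
  have hadd : lieBr (E := E) G W (u₀ + (u₁ + u₂)) =
      lieBr (E := E) G W u₁ + lieBr (E := E) G W u₂ := by
    refine (lieBr_add_right (E := E) W u₀ (u₁ + u₂)).trans ?_
    rw [hW₀ u₀ h₀, zero_add]
    exact lieBr_add_right (E := E) W u₁ u₂
  -- the factor `1 / λ` in `I^W` cancels the factor `λ` in the metric
  have h4 : S (lieBr (E := E) G W u₁ + (1 / lam) • lieBr (E := E) G W u₂) =
      lieBr (E := E) G W (u₀ + (u₁ + u₂)) := by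
    rw [map_add, map_smul, hS₁ _ (hW₁ u₁ h₁), hS₂ _ (hW₂ u₂ h₂), smul_smul,
      one_div_mul_cancel hlam.ne', one_smul, hadd]
  have h5 := hgp p (lieBr (E := E) G W u₁ + (1 / lam) • lieBr (E := E) G W u₂) v
  rw [h4] at h5
  exact (congrArg (fun w : F => g.inner (p : G ⧸ H) w (leftProj E F H p v)) h3).trans h5

end InvariantMetric

/-! ### The momentum of a charged particle -/

section Momentum

open Filter

variable {E : Type*} [NormedAddCommGroup E] [NormedSpace ℝ E] [FiniteDimensional ℝ E]
  {F : Type*} [NormedAddCommGroup F] [NormedSpace ℝ F]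
  {G : Type*} [TopologicalSpace G] [T2Space G] [ChartedSpace E G] [Group G]
  [LieGroup 𝓘(ℝ, E) ∞ G]
  {H : Subgroup G} [ChartedSpace F (G ⧸ H)]
  (hproj : IsSubmersion 𝓘(ℝ, E) 𝓘(ℝ, F) ∞ (fun p : G => (p : G ⧸ H)))

variable (H) in
/-- The fundamental vector field of `Z` on `G/H`. -/
def fundamentalField (Z : GroupLieAlgebra 𝓘(ℝ, E) G) (y : G ⧸ H) : TangentSpace 𝓘(ℝ, F) y :=
  modelDeriv 𝓘(ℝ, ℝ) 𝓘(ℝ, F) (fun s : ℝ => (lieExp (s • Z) : G) • y) 0 1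

include hproj

theorem fundamentalField_eq (Z : GroupLieAlgebra 𝓘(ℝ, E) G) {y : G ⧸ H} {p : G}
    (hy : y = (p : G ⧸ H)) :
    (fundamentalField H Z y : F) = leftProj E F H p (lieAd (E := E) p⁻¹ Z) := by
  subst hy
  exact modelDeriv_lieExp_smul_quotient hproj Z p

theorem contMDiff_lieExp_smul_quotient (Z : GroupLieAlgebra 𝓘(ℝ, E) G) :
    ContMDiff (𝓘(ℝ, ℝ).prod 𝓘(ℝ, F)) 𝓘(ℝ, F) 2
      (fun x : ℝ × (G ⧸ H) => (lieExp (x.1 • Z) : G) • x.2) :=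
  contMDiff_smul_quotient hproj (WithTop.coe_le_coe.2 le_top) (contMDiff_lieExp_smul Z)

variable [IsManifold 𝓘(ℝ, F) ∞ (G ⧸ H)]

theorem mdifferentiableAt_fundamentalField (Z : GroupLieAlgebra 𝓘(ℝ, E) G) (y : G ⧸ H) :
    MDiffAt (T% (fundamentalField (F := F) H Z)) y := by
  have h1 : ContMDiffAt 𝓘(ℝ, F) 𝓘(ℝ, ℝ).tangent 1
      (fun _ : G ⧸ H => (⟨0, (1 : ℝ)⟩ : TangentBundle 𝓘(ℝ, ℝ) ℝ)) y := contMDiffAt_const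
  have h2 : ContMDiffAt (𝓘(ℝ, F).prod 𝓘(ℝ, ℝ)) 𝓘(ℝ, F) 2
      (Function.uncurry fun (z : G ⧸ H) (s : ℝ) => (lieExp (s • Z) : G) • z) (y, 0) :=
    ((contMDiff_lieExp_smul_quotient hproj Z).comp
      (contMDiff_snd.prodMk contMDiff_fst)).contMDiffAt
  have h3 := (ContMDiffAt.mfderiv_totalSpace h2 h1 (by norm_num)).mdifferentiableAt (by norm_num)
  refine h3.congr_of_eventuallyEq (Eventually.of_forall fun z => ?_)
  exact tangentBundle_mk_congr (E := F) (by simp [lieExp_zero]) _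

variable [FiniteDimensional ℝ F]

/-- Noether's theorem for the action of `G` on `G/H`. -/
theorem IsLeviCivita.hasDerivAt_inner_fundamentalField
    {g : ContMDiffRiemannianMetric 𝓘(ℝ, F) ∞ F (fun x : G ⧸ H => TangentSpace 𝓘(ℝ, F) x)}
    (hginv : IsInvariantMetric g)
    {nabla : CovariantDerivative 𝓘(ℝ, F) F (fun x : G ⧸ H => TangentSpace 𝓘(ℝ, F) x)}
    (hnabla : IsLeviCivita g nabla) {y : ℝ → G ⧸ H} {t : ℝ}
    (hy : ContMDiffAt 𝓘(ℝ, ℝ) 𝓘(ℝ, F) 2 y t) (Z : GroupLieAlgebra 𝓘(ℝ, E) G) :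
    HasDerivAt (fun s => g.inner (y s) (velocity y s) (fundamentalField H Z (y s)))
      (g.inner (y t) (covDerivAlong nabla y (velocity y) t) (fundamentalField H Z (y t))) t :=
  hnabla.hasDerivAt_inner_velocity_killing (contMDiff_lieExp_smul_quotient hproj Z)
    (fun y => by simp [lieExp_zero]) (fun s y => by
      simp only [lieExp_neg_smul, inv_smul_smul])
    (fun s y u v => hginv (lieExp (s • Z)) y u v) (fun _ => rfl)
    (mdifferentiableAt_fundamentalField hproj Z (y t)) hy

variable {b : ContMDiffRiemannianMetric 𝓘(ℝ, E) ∞ E (fun x : G => TangentSpace 𝓘(ℝ, E) x)}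

/-- The momentum of a charged particle: if `p` is a lift of the curve `y` with body velocity `ξ`,
then `Ad p (S ξ + k W)` changes at the rate at which `y` fails to be a motion. -/
theorem IsLeviCivita.hasDerivAt_momentum (hb : IsBiInvariant b)
    {g : ContMDiffRiemannianMetric 𝓘(ℝ, F) ∞ F (fun x : G ⧸ H => TangentSpace 𝓘(ℝ, F) x)}
    (hginv : IsInvariantMetric g)
    {nabla : CovariantDerivative 𝓘(ℝ, F) F (fun x : G ⧸ H => TangentSpace 𝓘(ℝ, F) x)}
    (hnabla : IsLeviCivita g nabla)
    {J : ∀ x : G ⧸ H, TangentSpace 𝓘(ℝ, F) x →L[ℝ] TangentSpace 𝓘(ℝ, F) x} {W : E}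
    {S : E →L[ℝ] E}
    (hgS : ∀ (p : G) (u v : E), g.inner (p : G ⧸ H) (leftProj E F H p u) (leftProj E F H p v) =
        b.inner 1 (S u) v)
    (hJS : ∀ (p : G) (u v : E), g.inner (p : G ⧸ H) (J p (leftProj E F H p u))
      (leftProj E F H p v) = b.inner 1 (lieBr (E := E) G W u) v)
    (k : ℝ) {y : ℝ → G ⧸ H} {p : ℝ → G} {t : ℝ} (hy : ContMDiffAt 𝓘(ℝ, ℝ) 𝓘(ℝ, F) 2 y t)
    (hp : ∀ᶠ s in 𝓝 t, MDifferentiableAt 𝓘(ℝ, ℝ) 𝓘(ℝ, E) p s)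
    (hyp : ∀ᶠ s in 𝓝 t, y s = (p s : G ⧸ H)) (Z : E) :
    HasDerivAt (fun s => b.inner 1 (lieAd (p s) (S (bodyVelocity p s) + k • W) : E) Z)
      (g.inner (y t) (covDerivAlong nabla y (velocity y) t - k • J (y t) (velocity y t))
        (fundamentalField H Z (y t))) t := by
  let K : G ⧸ H → F := fundamentalField H Z
  have hK : ∀ {y : G ⧸ H} {q : G}, y = (q : G ⧸ H) → K y = leftProj E F H q (lieAd q⁻¹ Z) :=
    fun h => fundamentalField_eq hproj Z h
  let B : E →L[ℝ] E →L[ℝ] ℝ := b.inner 1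
  have hAd : ∀ (q : G) (u : E), B u (lieAd q⁻¹ Z) = B (lieAd q u) Z := fun q u => by
    have h := hb.inner_lieAd q u (lieAd q⁻¹ Z)
    rw [lieAd_apply_inv] at h
    exact h.symm
  have hvel : ∀ᶠ s in 𝓝 t, (velocity y s : F) = leftProj E F H (p s) (bodyVelocity p s) := by
    filter_upwards [hp, hyp.eventually_nhds] with s hs hs'
    rw [← modelDeriv_proj_curve hproj hs]
    exact congrArg (fun A : ℝ →L[ℝ] F => A 1) (modelDeriv_congr hs')
  have h1 : HasDerivAt (fun s => g.inner (y s) (velocity y s) (K (y s)))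
      (g.inner (y t) (covDerivAlong nabla y (velocity y) t) (K (y t))) t :=
    hnabla.hasDerivAt_inner_fundamentalField hproj hginv hy Z
  have h2 : (fun s => B (lieAd (p s) (S (bodyVelocity p s))) Z) =ᶠ[𝓝 t]
      fun s => g.inner (y s) (velocity y s) (K (y s)) := by
    filter_upwards [hyp, hvel] with s hs hs'
    rw [← hAd]
    refine (hgS (p s) _ _).symm.trans (Eq.trans ?_ (metric_inner_congr g hs (velocity y s)
      (K (y s))).symm)
    rw [hs', hK hs]
  have h3 := (B.flip Z).hasFDerivAt.comp_hasDerivAt t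
    (hasDerivAt_lieAd_curve hp.self_of_nhds W)
  have h4 : B (lieAd (p t) (lieBr G (bodyVelocity p t) W)) Z =
      -g.inner (y t) (J (y t) (velocity y t)) (K (y t)) := by
    have hs := hyp.self_of_nhds
    have h5 := hJS (p t) (bodyVelocity p t) (lieAd (p t)⁻¹ Z)
    have h6 := metric_inner_congr g hs (J (y t) (velocity y t))
      (K (y t))
    rw [lieBr_skew, map_neg, map_neg, neg_apply]
    refine congrArg Neg.neg ?_
    rw [← hAd]
    refine h5.symm.trans (Eq.trans ?_ h6.symm)
    rw [hK hs, hvel.self_of_nhds]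
    congr 2
    exact (tensor_congr hs _).symm
  have h7 := (h1.congr_of_eventuallyEq h2).add (h3.const_mul k)
  have h8 : (fun s => B (lieAd (p s) (S (bodyVelocity p s) + k • W)) Z) =
      fun s => B (lieAd (p s) (S (bodyVelocity p s))) Z + k * B (lieAd (p s) W) Z := by
    ext s
    simp
  have h9 := h7.congr_deriv (g' := g.inner (y t) (covDerivAlong nabla y (velocity y) t -
    k • J (y t) (velocity y t)) (K (y t))) (by
      have h10 : (B.flip Z) (lieAd (p t) (lieBr G (bodyVelocity p t) W)) =
        -g.inner (y t) (J (y t) (velocity y t)) (K (y t)) := h4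
      rw [h10, map_sub, map_smul, mul_neg, ← sub_eq_add_neg]
      rfl)
  exact h9.congr_of_eventuallyEq (Eventually.of_forall fun s => congrFun h8 s)

end Momentum

/-! ### Body velocity of a product; curves of constant momentum -/

section BodyVelocityMul

variable {E : Type*} [NormedAddCommGroup E] [NormedSpace ℝ E]
  {G : Type*} [TopologicalSpace G] [ChartedSpace E G] [Group G] [LieGroup 𝓘(ℝ, E) ∞ G]

theorem modelDeriv_mul_of_eq_one {u v : ℝ → G} {t : ℝ} (hu : MDifferentiableAt 𝓘(ℝ, ℝ) 𝓘(ℝ, E) u t)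
    (hv : MDifferentiableAt 𝓘(ℝ, ℝ) 𝓘(ℝ, E) v t) (hu1 : u t = 1) (hv1 : v t = 1) :
    modelDeriv 𝓘(ℝ, ℝ) 𝓘(ℝ, E) (fun s => u s * v s) t 1 =
      modelDeriv 𝓘(ℝ, ℝ) 𝓘(ℝ, E) u t 1 + modelDeriv 𝓘(ℝ, ℝ) 𝓘(ℝ, E) v t 1 := by
  have hm : MDifferentiableAt (𝓘(ℝ, E).prod 𝓘(ℝ, E)) 𝓘(ℝ, E) (fun z : G × G => z.1 * z.2)
      ((1 : G), (1 : G)) :=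
    ((contMDiff_mul 𝓘(ℝ, E) ∞).mdifferentiable (by simp)) _
  have h1 := modelDeriv_comp_apply (y := ((1 : G), (1 : G))) hm (hu.prodMk hv)
    (by rw [hu1, hv1]) (1 : ℝ)
  have h2 : modelDeriv 𝓘(ℝ, ℝ) (𝓘(ℝ, E).prod 𝓘(ℝ, E)) (fun s => (u s, v s)) t 1 =
      (modelDeriv 𝓘(ℝ, ℝ) 𝓘(ℝ, E) u t 1, modelDeriv 𝓘(ℝ, ℝ) 𝓘(ℝ, E) v t 1) :=
    congrArg (fun A : ℝ →L[ℝ] E × E => A 1) (hu.mfderiv_prod hv)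
  rw [h2] at h1
  refine h1.trans ((mfderiv_prod_eq_add_apply hm).trans ?_)
  have h3 : modelDeriv 𝓘(ℝ, E) 𝓘(ℝ, E) (fun z : G => z * 1) 1 = ContinuousLinearMap.id ℝ E := by
    simp [modelDeriv_id]
  have h4 : modelDeriv 𝓘(ℝ, E) 𝓘(ℝ, E) (fun z : G => 1 * z) 1 = ContinuousLinearMap.id ℝ E := by
    simp [modelDeriv_id]
  exact congrArg₂ (· + ·) (congrArg (fun A : E →L[ℝ] E => A (modelDeriv 𝓘(ℝ, ℝ) 𝓘(ℝ, E) u t 1)) h3)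
    (congrArg (fun A : E →L[ℝ] E => A (modelDeriv 𝓘(ℝ, ℝ) 𝓘(ℝ, E) v t 1)) h4)

/-- The product rule for body velocities. -/
theorem bodyVelocity_mul {p q : ℝ → G} {t : ℝ} (hp : MDifferentiableAt 𝓘(ℝ, ℝ) 𝓘(ℝ, E) p t)
    (hq : MDifferentiableAt 𝓘(ℝ, ℝ) 𝓘(ℝ, E) q t) :
    bodyVelocity (E := E) (fun s => p s * q s) t =
      lieAd (q t)⁻¹ (bodyVelocity (E := E) p t) + bodyVelocity (E := E) q t := by
  have h1 : MDifferentiableAt 𝓘(ℝ, ℝ) 𝓘(ℝ, E) (fun s => (p t)⁻¹ * p s) t :=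
    MDifferentiableAt.comp t (mdifferentiable_leftMul (E := E) (p t)⁻¹ _) hp
  have h2 : MDifferentiableAt 𝓘(ℝ, ℝ) 𝓘(ℝ, E) (fun s => (q t)⁻¹ * q s) t :=
    MDifferentiableAt.comp t (mdifferentiable_leftMul (E := E) (q t)⁻¹ _) hq
  have h3 : MDifferentiableAt 𝓘(ℝ, ℝ) 𝓘(ℝ, E)
      (fun s => (q t)⁻¹ * ((p t)⁻¹ * p s) * ((q t)⁻¹)⁻¹) t :=
    MDifferentiableAt.comp (g := fun r => (q t)⁻¹ * r * ((q t)⁻¹)⁻¹) t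
      (mdifferentiable_conj (E := E) (q t)⁻¹ _) h1
  have h4 := modelDeriv_mul_of_eq_one h3 h2 (by simp) (by simp)
  have h5 := modelDeriv_comp_apply (y := (1 : G)) (mdifferentiable_conj (E := E) (q t)⁻¹ _) h1
    (by simp) 1
  rw [h5] at h4
  refine Eq.trans ?_ h4
  rw [bodyVelocity]
  congr 2
  ext s
  group

end BodyVelocityMul

section Motion

open Filter

variable {E : Type*} [NormedAddCommGroup E] [NormedSpace ℝ E] [FiniteDimensional ℝ E]
  {F : Type*} [NormedAddCommGroup F] [NormedSpace ℝ F] [FiniteDimensional ℝ F]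
  {G : Type*} [TopologicalSpace G] [T2Space G] [ChartedSpace E G] [Group G]
  [LieGroup 𝓘(ℝ, E) ∞ G]
  {H : Subgroup G} [ChartedSpace F (G ⧸ H)] [IsManifold 𝓘(ℝ, F) ∞ (G ⧸ H)]
  (hproj : IsSubmersion 𝓘(ℝ, E) 𝓘(ℝ, F) ∞ (fun p : G => (p : G ⧸ H)))
  {b : ContMDiffRiemannianMetric 𝓘(ℝ, E) ∞ E (fun x : G => TangentSpace 𝓘(ℝ, E) x)}
  (hb : IsBiInvariant b)
  {g : ContMDiffRiemannianMetric 𝓘(ℝ, F) ∞ F (fun x : G ⧸ H => TangentSpace 𝓘(ℝ, F) x)}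
  (hginv : IsInvariantMetric g)
  {nabla : CovariantDerivative 𝓘(ℝ, F) F (fun x : G ⧸ H => TangentSpace 𝓘(ℝ, F) x)}
  (hnabla : IsLeviCivita g nabla)
  {J : ∀ x : G ⧸ H, TangentSpace 𝓘(ℝ, F) x →L[ℝ] TangentSpace 𝓘(ℝ, F) x} {W : E}
  {S : E →L[ℝ] E}
  (hgS : ∀ (p : G) (u v : E), g.inner (p : G ⧸ H) (leftProj E F H p u) (leftProj E F H p v) =
    b.inner 1 (S u) v)
  (hJS : ∀ (p : G) (u v : E), g.inner (p : G ⧸ H) (J p (leftProj E F H p u))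
    (leftProj E F H p v) = b.inner 1 (lieBr (E := E) G W u) v)

include hproj hb hginv hnabla hgS hJS

/-- A curve whose momentum is constant satisfies the equation of motion. -/
theorem covDerivAlong_eq_of_momentum_eq {k : ℝ} {p : ℝ → G} {y : ℝ → G ⧸ H}
    (hy : ContMDiff 𝓘(ℝ, ℝ) 𝓘(ℝ, F) 2 y)
    (hp : MDifferentiable 𝓘(ℝ, ℝ) 𝓘(ℝ, E) p) (hyp : ∀ s, y s = (p s : G ⧸ H)) {a : E}
    (ha : ∀ s, lieAd (p s) (S (bodyVelocity p s) + k • W) = a) (t : ℝ) :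
    covDerivAlong nabla y (velocity y) t = k • J (y t) (velocity y t) := by
  let D : F := covDerivAlong nabla y (velocity y) t - k • J (y t) (velocity y t)
  let g₀ : F →L[ℝ] F →L[ℝ] ℝ := g.inner (y t)
  have h1 : ∀ Z : E, g₀ D (leftProj E F H (p t) (lieAd (p t)⁻¹ Z)) = 0 := fun Z => by
    have h2 := hnabla.hasDerivAt_momentum hproj hb hginv hgS hJS k hy.contMDiffAt
      (Eventually.of_forall hp) (Eventually.of_forall hyp) Z (t := t)
    simp only [ha] at h2
    have h3 := h2.unique (hasDerivAt_const t (b.inner 1 a Z))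
    rwa [fundamentalField_eq hproj Z (hyp t)] at h3
  by_contra hne
  have hD : D ≠ 0 := sub_ne_zero.2 hne
  obtain ⟨u, hu⟩ := leftProj_surjective hproj (p t) D
  have h4 := h1 (lieAd (p t) u)
  rw [lieAd_inv_apply, hu] at h4
  exact (g.pos (y t) D hD).ne' h4

end Motion

/-! ### The momentum of the explicit curve; the momentum field -/

section ConstantMomentum

variable {E : Type*} [NormedAddCommGroup E] [NormedSpace ℝ E] [FiniteDimensional ℝ E]
  {G : Type*} [TopologicalSpace G] [T2Space G] [ChartedSpace E G] [Group G]
  [LieGroup 𝓘(ℝ, E) ∞ G]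

theorem bodyVelocity_lieExp_mul_lieExp (a c : GroupLieAlgebra 𝓘(ℝ, E) G) {a' c' : E} (ha : a = a')
    (hc : c = c') (t : ℝ) :
    bodyVelocity (E := E) (fun s : ℝ => (lieExp (s • a) * lieExp (s • c) : G)) t =
      lieAd (lieExp (t • c) : G)⁻¹ a' + c' := by
  have h := bodyVelocity_mul (mdifferentiable_lieExp_smul a t) (mdifferentiable_lieExp_smul c t)
  rw [bodyVelocity_lieExp_smul, bodyVelocity_lieExp_smul] at h
  exact h.trans (congrArg₂ (· + ·) (congrArg (lieAd (E := E) (lieExp (t • c) : G)⁻¹) ha) hc)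

/-- The momentum of the curve `exp (t a) exp (t c)` is constantly equal to `a`, where
`a = X₁ + λ X₂ + k W` and `c = (1 - λ) (X₂ + (k / λ) W)`. -/
theorem momentum_lieExp_mul_lieExp {S : E →L[ℝ] E} {𝔪₁ : Submodule ℝ E} {X₁ X₂ W : E} {k lam : ℝ}
    (hlam : lam ≠ 0) (hS₁ : ∀ X ∈ 𝔪₁, S X = X) (hS₂ : S X₂ = lam • X₂) (hSW : S W = 0)
    (hm : ∀ Z ∈ 𝔪₁, lieBr G (X₂ + (k / lam) • W) Z ∈ 𝔪₁) (hX₁ : X₁ ∈ 𝔪₁)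
    {a c : GroupLieAlgebra 𝓘(ℝ, E) G} (ha : a = (X₁ + lam • X₂ + k • W : E))
    (hc : c = ((1 - lam) • (X₂ + (k / lam) • W) : E)) (t : ℝ) :
    lieAd (lieExp (t • a) * lieExp (t • c) : G)
      (S (bodyVelocity (E := E) (fun s : ℝ => (lieExp (s • a) * lieExp (s • c) : G)) t) + k • W) =
      a := by
  let e : E := X₂ + (k / lam) • W
  have hd : lam • X₂ + k • W = lam • e := by
    simp only [e, smul_add, smul_smul]
    rw [mul_div_cancel₀ k hlam]
  have hce : c = ((1 - lam) • e : E) := hc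
  -- `c` commutes with `d = λ X₂ + k W`, and `ad c` preserves `𝔪₁`
  have h1 : lieAd (lieExp (t • c) : G)⁻¹ (lam • e) = lam • e := by
    rw [← lieExp_neg_smul]
    refine lieAd_lieExp_of_lieBr_eq_zero c ?_ (-t)
    rw [hce, lieBr_smul_left, lieBr_smul_right, lieBr_self, smul_zero, smul_zero]
  have h2 : lieAd (lieExp (t • c) : G)⁻¹ X₁ ∈ 𝔪₁ := by
    rw [← lieExp_neg_smul]
    refine lieAd_lieExp_mem c (fun Z hZ => ?_) hX₁ (-t)
    rw [hce, lieBr_smul_left]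
    exact 𝔪₁.smul_mem _ (hm Z hZ)
  have ha' : a = (X₁ + lam • e : E) := by rw [ha, add_assoc, hd]
  have h3 : lieAd (lieExp (t • c) : G)⁻¹ (X₁ + lam • e) =
      lieAd (lieExp (t • c) : G)⁻¹ X₁ + lam • e := by rw [map_add, h1]
  have h4 : bodyVelocity (E := E) (fun s : ℝ => (lieExp (s • a) * lieExp (s • c) : G)) t =
      lieAd (lieExp (t • c) : G)⁻¹ X₁ + e := by
    rw [bodyVelocity_lieExp_mul_lieExp a c ha' hce, h3, add_assoc, ← add_smul]
    simp
  have h6 : S (bodyVelocity (E := E) (fun s : ℝ => (lieExp (s • a) * lieExp (s • c) : G)) t) +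
      k • W = lieAd (lieExp (t • c) : G)⁻¹ (X₁ + lam • e) := by
    rw [h4, h3, map_add, hS₁ _ h2, ← hd]
    simp only [e, map_add, map_smul, hS₂, hSW, smul_zero, add_zero, add_assoc]
  rw [h6, lieAd_mul, lieAd_apply_inv]
  refine Eq.trans ?_ ha'.symm
  refine lieAd_lieExp_of_lieBr_eq_zero a ?_ t
  rw [ha', lieBr_self]

end ConstantMomentum

section Uniqueness

open Filter

variable {E : Type*} [NormedAddCommGroup E] [NormedSpace ℝ E] [FiniteDimensional ℝ E]
  {F : Type*} [NormedAddCommGroup F] [NormedSpace ℝ F] [FiniteDimensional ℝ F]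
  {G : Type*} [TopologicalSpace G] [T2Space G] [ChartedSpace E G] [Group G]
  [LieGroup 𝓘(ℝ, E) ∞ G]
  {H : Subgroup G} [ChartedSpace F (G ⧸ H)] [IsManifold 𝓘(ℝ, F) ∞ (G ⧸ H)]
  {b : ContMDiffRiemannianMetric 𝓘(ℝ, E) ∞ E (fun x : G => TangentSpace 𝓘(ℝ, E) x)}
  {g : ContMDiffRiemannianMetric 𝓘(ℝ, F) ∞ F (fun x : G ⧸ H => TangentSpace 𝓘(ℝ, F) x)}
  {S : E →L[ℝ] E}

omit [FiniteDimensional ℝ E] [T2Space G] in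
theorem eq_of_inner_one_eq {u v : E} (h : ∀ w : E, b.inner 1 u w = b.inner 1 v w) : u = v := by
  let B : E →L[ℝ] E →L[ℝ] ℝ := b.inner 1
  by_contra hne
  have h1 : 0 < B (u - v) (u - v) := b.pos 1 (u - v : E) (sub_ne_zero.2 hne)
  have h2 : B u (u - v) = B v (u - v) := h _
  rw [map_sub B, sub_apply, h2, sub_self] at h1
  exact lt_irrefl _ h1

omit [FiniteDimensional ℝ E] [FiniteDimensional ℝ F] [T2Space G] in
/-- `S` has the same kernel as the differential of the projection, so that `S u` determines the
projection of `u`. -/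
theorem leftProj_eq_iff
    (hgS : ∀ (p : G) (u v : E), g.inner (p : G ⧸ H) (leftProj E F H p u) (leftProj E F H p v) =
      b.inner 1 (S u) v) (p : G) {u v : E} :
    leftProj E F H p u = leftProj E F H p v ↔ S u = S v := by
  constructor
  · intro h
    refine eq_of_inner_one_eq (b := b) fun w => ?_
    exact (hgS p u w).symm.trans ((congrArg (fun x : F => g.inner (p : G ⧸ H) x
      (leftProj E F H p w)) h).trans (hgS p v w))
  · intro h
    by_contra hne
    let D : F := leftProj E F H p (u - v)
    have hD : D ≠ 0 := fun h0 => hne (sub_eq_zero.1 ((map_sub (leftProj E F H p) u v).symm.trans h0))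
    have h1 : 0 < g.inner (p : G ⧸ H) D D := g.pos (p : G ⧸ H) D hD
    have h2 : g.inner (p : G ⧸ H) D D = b.inner 1 (S (u - v)) (u - v) := hgS p (u - v) (u - v)
    rw [h2, map_sub S, h, sub_self] at h1
    have h3 : b.inner 1 (0 : E) (u - v) = 0 :=
      congrArg (fun l : E →L[ℝ] ℝ => l (u - v)) (map_zero (b.inner 1 : E →L[ℝ] E →L[ℝ] ℝ))
    exact h1.ne' h3

variable (hproj : IsSubmersion 𝓘(ℝ, E) 𝓘(ℝ, F) ∞ (fun p : G => (p : G ⧸ H)))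

/-- The vector field on `G/H`, defined in terms of a local section `σ` of the projection, whose
integral curves are the motions with momentum `A`. Here `R` is meant to be a generalized inverse of
the endomorphism `S` which represents the metric: it recovers `p⁻¹ p'`, up to `𝔥`, from its image
under `S`, which is determined by the momentum. -/
def momentumField (R : E →L[ℝ] E) (W A : E) (k : ℝ) (σ : G ⧸ H → G) (z : G ⧸ H) :
    TangentSpace 𝓘(ℝ, F) z :=
  leftProj E F H (σ z) (R (lieAd (σ z)⁻¹ A - k • W))

include hproj

omit [FiniteDimensional ℝ E] [FiniteDimensional ℝ F] [T2Space G] in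
/-- Near a point where `σ` is a smooth section, the momentum field is the partial differential of
`(y, q) ↦ σ y q H` at `q = 1`, applied to a smooth family of vectors. -/
theorem contMDiffAt_momentumField (R : E →L[ℝ] E) (W A : E) (k : ℝ) {σ : G ⧸ H → G} {z : G ⧸ H}
    (hσ : ContMDiffAt 𝓘(ℝ, F) 𝓘(ℝ, E) ∞ σ z) (hσz : ∀ᶠ y in 𝓝 z, (σ y : G ⧸ H) = y) :
    ContMDiffAt 𝓘(ℝ, F) 𝓘(ℝ, F).tangent 1
      (T% (momentumField (F := F) (H := H) R W A k σ)) z := by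
  have hσ1 := hσ.of_le (m := 1) (by simp)
  have h1 : ContMDiffAt 𝓘(ℝ, F) 𝓘(ℝ, E) 1 (fun y => R (lieAd (σ y)⁻¹ A - k • W)) z := by
    have h2 : ContMDiffAt 𝓘(ℝ, F) 𝓘(ℝ, E) 1 (fun y => (σ y)⁻¹) z := (hσ.inv).of_le (by simp)
    have h3 : ContMDiffAt 𝓘(ℝ, F) 𝓘(ℝ, E) 1 (fun y => lieAd (σ y)⁻¹ A) z :=
      ((contMDiff_lieAd A).of_le (by simp)).contMDiffAt.comp z h2
    have h4 : ContDiff ℝ 1 (fun v : E => R (v - k • W)) :=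
      R.contDiff.comp (contDiff_id.sub contDiff_const)
    exact h4.contMDiff.contMDiffAt.comp z h3
  have h2 : ContMDiffAt 𝓘(ℝ, F) 𝓘(ℝ, E).tangent 1
      (fun y => (⟨1, R (lieAd (σ y)⁻¹ A - k • W)⟩ : TangentBundle 𝓘(ℝ, E) G)) z :=
    (contMDiffAt_mk_tangentSpace (M := G) 1).2 h1
  have h3 : ContMDiffAt (𝓘(ℝ, F).prod 𝓘(ℝ, E)) 𝓘(ℝ, F) ∞
      (Function.uncurry fun (y : G ⧸ H) (q : G) => ((σ y * q : G) : G ⧸ H)) (z, 1) :=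
    hproj.contMDiff.contMDiffAt.comp (z, (1 : G))
      ((hσ.comp (z, (1 : G)) contMDiffAt_fst).mul contMDiffAt_snd)
  have h4 := ContMDiffAt.mfderiv_totalSpace h3 h2 (n := ∞)
    (by rw [one_add_one_eq_two]; exact WithTop.coe_le_coe.2 le_top)
  refine h4.congr_of_eventuallyEq ?_
  filter_upwards [hσz] with y hy
  exact tangentBundle_mk_congr (E := F) (by simp [hy]) _

end Uniqueness

/-! ### Local uniqueness and continuation of motions -/

section LocalUniqueness

open Filter

variable {E : Type*} [NormedAddCommGroup E] [NormedSpace ℝ E] [FiniteDimensional ℝ E]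
  {F : Type*} [NormedAddCommGroup F] [NormedSpace ℝ F] [FiniteDimensional ℝ F]
  {G : Type*} [TopologicalSpace G] [T2Space G] [ChartedSpace E G] [Group G]
  [LieGroup 𝓘(ℝ, E) ∞ G]
  {H : Subgroup G} [ChartedSpace F (G ⧸ H)] [IsManifold 𝓘(ℝ, F) ∞ (G ⧸ H)]
  (hproj : IsSubmersion 𝓘(ℝ, E) 𝓘(ℝ, F) ∞ (fun p : G => (p : G ⧸ H)))
  {b : ContMDiffRiemannianMetric 𝓘(ℝ, E) ∞ E (fun x : G => TangentSpace 𝓘(ℝ, E) x)}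
  (hb : IsBiInvariant b)
  {g : ContMDiffRiemannianMetric 𝓘(ℝ, F) ∞ F (fun x : G ⧸ H => TangentSpace 𝓘(ℝ, F) x)}
  (hginv : IsInvariantMetric g)
  {nabla : CovariantDerivative 𝓘(ℝ, F) F (fun x : G ⧸ H => TangentSpace 𝓘(ℝ, F) x)}
  (hnabla : IsLeviCivita g nabla)
  {J : ∀ x : G ⧸ H, TangentSpace 𝓘(ℝ, F) x →L[ℝ] TangentSpace 𝓘(ℝ, F) x} {W : E}
  {S : E →L[ℝ] E}
  (hgS : ∀ (p : G) (u v : E), g.inner (p : G ⧸ H) (leftProj E F H p u) (leftProj E F H p v) =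
    b.inner 1 (S u) v)
  (hJS : ∀ (p : G) (u v : E), g.inner (p : G ⧸ H) (J p (leftProj E F H p u))
    (leftProj E F H p v) = b.inner 1 (lieBr (E := E) G W u) v)

include hproj hb hginv hnabla hgS hJS

/-- Conservation of momentum: a motion is an integral curve of the momentum field which is
determined by its initial velocity. -/
theorem isMIntegralCurveAt_momentumField {R : E →L[ℝ] E} (hR : ∀ v, S (R (S v)) = S v) {k : ℝ}
    {σ : G ⧸ H → G} {y : ℝ → G ⧸ H} {t₀ : ℝ}
    (hy : ∀ᶠ t in 𝓝 t₀, ContMDiffAt 𝓘(ℝ, ℝ) 𝓘(ℝ, F) 2 y t ∧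
      covDerivAlong nabla y (velocity y) t = k • J (y t) (velocity y t))
    (hσ : ∀ᶠ z in 𝓝 (y t₀), ContMDiffAt 𝓘(ℝ, F) 𝓘(ℝ, E) ∞ σ z)
    (hσz : ∀ᶠ z in 𝓝 (y t₀), (σ z : G ⧸ H) = z) {v : E}
    (hv : modelDeriv 𝓘(ℝ, ℝ) 𝓘(ℝ, F) y t₀ 1 = leftProj E F H (σ (y t₀)) v) :
    IsMIntegralCurveAt (I := 𝓘(ℝ, F)) y
      (momentumField R W (lieAd (σ (y t₀)) (S v + k • W)) k σ) t₀ := by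
  let q : ℝ → G := fun t => σ (y t)
  let A : E := lieAd (σ (y t₀)) (S v + k • W)
  have hyc : ContinuousAt y t₀ := hy.self_of_nhds.1.continuousAt
  have hall := (hy.and (hyc.eventually hσ)).and (hyc.eventually hσz)
  have hq : ∀ᶠ t in 𝓝 t₀, MDifferentiableAt 𝓘(ℝ, ℝ) 𝓘(ℝ, E) q t := by
    filter_upwards [hall] with t ht
    exact MDifferentiableAt.comp t (ht.1.2.mdifferentiableAt (by simp))
      (ht.1.1.1.mdifferentiableAt (by norm_num))
  have hyq : ∀ᶠ t in 𝓝 t₀, y t = (q t : G ⧸ H) := by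
    filter_upwards [hall] with t ht
    exact ht.2.symm
  have hvel : ∀ᶠ t in 𝓝 t₀, modelDeriv 𝓘(ℝ, ℝ) 𝓘(ℝ, F) y t 1 =
      leftProj E F H (q t) (bodyVelocity q t) := by
    filter_upwards [hq, hyq.eventually_nhds] with t ht ht'
    rw [← modelDeriv_proj_curve hproj ht, modelDeriv_congr ht']
  -- the momentum is locally constant
  have hder : ∀ᶠ t in 𝓝 t₀, ∀ Z : E,
      HasDerivAt (fun s => b.inner 1 (lieAd (q s) (S (bodyVelocity q s) + k • W) : E) Z) 0 t := by
    filter_upwards [hy, hq.eventually_nhds, hyq.eventually_nhds] with t h1 h2 h3 Z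
    refine (hnabla.hasDerivAt_momentum hproj hb hginv hgS hJS k h1.1 h2 h3 Z).congr_deriv ?_
    rw [h1.2, sub_self]
    exact congrArg (fun l : F →L[ℝ] ℝ => l (fundamentalField (E := E) (F := F) H Z (y t)))
      (map_zero (g.inner (y t) : F →L[ℝ] F →L[ℝ] ℝ))
  have hmom : ∀ᶠ t in 𝓝 t₀, lieAd (q t) (S (bodyVelocity q t) + k • W) = A := by
    obtain ⟨ε, hε, hball⟩ := Metric.eventually_nhds_iff_ball.1 hder
    have h0 : lieAd (q t₀) (S (bodyVelocity q t₀) + k • W) = A := by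
      have h1 : S (bodyVelocity q t₀) = S v :=
        (leftProj_eq_iff hgS (q t₀)).1 (hvel.self_of_nhds.symm.trans hv)
      rw [h1]
    filter_upwards [Metric.ball_mem_nhds t₀ hε] with t ht
    rw [← h0]
    refine eq_of_inner_one_eq (b := b) fun Z => ?_
    exact Metric.isOpen_ball.is_const_of_deriv_eq_zero (convex_ball t₀ ε).isPreconnected
      (fun s hs => (hball s hs Z).differentiableAt.differentiableWithinAt)
      (fun s hs => (hball s hs Z).deriv) ht (Metric.mem_ball_self hε)
  filter_upwards [hmom, hall, hvel] with t h1 h2 h3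
  refine hasMFDerivAt_curve (h2.1.1.1.mdifferentiableAt (by norm_num)) ?_
  rw [h3]
  refine (leftProj_eq_iff hgS (q t)).2 ?_
  have h4 : lieAd (q t)⁻¹ A - k • W = S (bodyVelocity q t) := by
    rw [← h1, lieAd_inv_apply, add_sub_cancel_right]
  rw [← hR, ← h4]

/-- Two motions with the same initial conditions agree locally. -/
theorem eventuallyEq_of_motion {k : ℝ} {y₁ y₂ : ℝ → G ⧸ H} {t₀ : ℝ}
    (hy₁ : ∀ᶠ t in 𝓝 t₀, ContMDiffAt 𝓘(ℝ, ℝ) 𝓘(ℝ, F) 2 y₁ t ∧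
      covDerivAlong nabla y₁ (velocity y₁) t = k • J (y₁ t) (velocity y₁ t))
    (hy₂ : ∀ᶠ t in 𝓝 t₀, ContMDiffAt 𝓘(ℝ, ℝ) 𝓘(ℝ, F) 2 y₂ t ∧
      covDerivAlong nabla y₂ (velocity y₂) t = k • J (y₂ t) (velocity y₂ t))
    (h0 : y₁ t₀ = y₂ t₀)
    (hv : modelDeriv 𝓘(ℝ, ℝ) 𝓘(ℝ, F) y₁ t₀ 1 = modelDeriv 𝓘(ℝ, ℝ) 𝓘(ℝ, F) y₂ t₀ 1) :
    y₁ =ᶠ[𝓝 t₀] y₂ := by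
  have : CompleteSpace F := FiniteDimensional.complete ℝ F
  obtain ⟨p, hp⟩ := QuotientGroup.mk_surjective (y₁ t₀)
  obtain ⟨σ, -, hσ, hσz⟩ := exists_local_section (hproj.isSubmersionAt p)
  replace hσ : ∀ᶠ z in 𝓝 (y₁ t₀), ContMDiffAt 𝓘(ℝ, F) 𝓘(ℝ, E) ∞ σ z := hp ▸ hσ
  replace hσz : ∀ᶠ z in 𝓝 (y₁ t₀), (σ z : G ⧸ H) = z := hp ▸ hσz
  obtain ⟨R, hR⟩ := exists_generalized_inverse S
  obtain ⟨v, hv'⟩ := leftProj_surjective hproj (σ (y₁ t₀)) (modelDeriv 𝓘(ℝ, ℝ) 𝓘(ℝ, F) y₁ t₀ 1)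
  have h1 := isMIntegralCurveAt_momentumField hproj hb hginv hnabla hgS hJS hR hy₁ hσ hσz hv'.symm
  have h2 := isMIntegralCurveAt_momentumField hproj hb hginv hnabla hgS hJS hR (σ := σ) hy₂
    (h0 ▸ hσ) (h0 ▸ hσz) (v := v) (by rw [← h0, ← hv, hv'])
  rw [← h0] at h2
  exact isMIntegralCurveAt_eventuallyEq_of_contMDiffAt_boundaryless
    (contMDiffAt_momentumField hproj R W _ k hσ.self_of_nhds hσz) h1 h2 h0

end LocalUniqueness

section Continuation

open Filter

variable {F : Type*} [NormedAddCommGroup F] [NormedSpace ℝ F]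
  {M : Type*} [TopologicalSpace M] [ChartedSpace F M] [IsManifold 𝓘(ℝ, F) ∞ M]

/-- Two `C²` curves which agree near times accumulating at `t` agree to first order at `t`. -/
theorem eq_and_modelDeriv_eq_of_frequently [T2Space M] {x y : ℝ → M} {t : ℝ}
    (hx : ContMDiffAt 𝓘(ℝ, ℝ) 𝓘(ℝ, F) 2 x t) (hy : ContMDiffAt 𝓘(ℝ, ℝ) 𝓘(ℝ, F) 2 y t)
    (h : ∃ᶠ s in 𝓝 t, y =ᶠ[𝓝 s] x) :
    y t = x t ∧ modelDeriv 𝓘(ℝ, ℝ) 𝓘(ℝ, F) y t 1 = modelDeriv 𝓘(ℝ, ℝ) 𝓘(ℝ, F) x t 1 := by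
  have hxy : y t = x t := tendsto_nhds_unique_of_frequently_eq hy.continuousAt hx.continuousAt
    (h.mono fun s hs => hs.self_of_nhds)
  refine ⟨hxy, ?_⟩
  let φ : M → F := extChartAt 𝓘(ℝ, F) (x t)
  have hφ : ContMDiffAt 𝓘(ℝ, F) 𝓘(ℝ, F) ∞ φ (x t) := contMDiffAt_extChartAt
  have key : ∀ z : ℝ → M, z t = x t → ContMDiffAt 𝓘(ℝ, ℝ) 𝓘(ℝ, F) 2 z t →
      ContinuousAt (fderiv ℝ (fun s => φ (z s))) t ∧
      modelDeriv 𝓘(ℝ, ℝ) 𝓘(ℝ, F) z t = fderiv ℝ (fun s => φ (z s)) t := by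
    intro z hz hzd
    have h1 : ContMDiffAt 𝓘(ℝ, ℝ) 𝓘(ℝ, F) 2 (fun s => φ (z s)) t :=
      ContMDiffAt.comp_of_eq (hφ.of_le (WithTop.coe_le_coe.2 le_top)) hzd hz
    refine ⟨(h1.contDiffAt.fderiv_right (m := 1) (by norm_num)).continuousAt, ?_⟩
    have h2 := modelDeriv_comp (hφ.mdifferentiableAt (by simp)) (hzd.mdifferentiableAt
      (by norm_num)) hz
    rw [modelDeriv_eq_fderiv, modelDeriv_extChartAt_self] at h2
    rw [h2, ContinuousLinearMap.id_comp]
  obtain ⟨hx1, hx2⟩ := key x rfl hx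
  obtain ⟨hy1, hy2⟩ := key y hxy hy
  rw [hx2, hy2]
  refine congrArg (fun A : ℝ →L[ℝ] F => A 1) (tendsto_nhds_unique_of_frequently_eq hy1 hx1
    (h.mono fun s hs => ?_))
  exact Filter.EventuallyEq.fderiv_eq (hs.mono fun r hr => congrArg φ hr)

end Continuation

/-! ### The motion of a charged particle -/

theorem tangentBundle_mk_inj {F : Type*} [NormedAddCommGroup F] [NormedSpace ℝ F] {M : Type*}
    [TopologicalSpace M] [ChartedSpace F M] {x y : M} {u v : F}
    (h : (⟨x, u⟩ : TangentBundle 𝓘(ℝ, F) M) = ⟨y, v⟩) : x = y ∧ u = v := by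
  injection h with h1 h2
  exact ⟨h1, h2⟩

end

theorem theorem2
    -- the Lie group `G` with a bi-invariant metric `b`
    {E : Type*} [NormedAddCommGroup E] [NormedSpace ℝ E] [FiniteDimensional ℝ E]
    {G : Type*} [TopologicalSpace G] [T2Space G] [ChartedSpace E G] [Group G]
    [LieGroup 𝓘(ℝ, E) ∞ G]
    (b : ContMDiffRiemannianMetric 𝓘(ℝ, E) ∞ E (fun x : G => TangentSpace 𝓘(ℝ, E) x))
    (hb : IsBiInvariant b)
    -- closed connected subgroups `H ⊆ K ⊆ G`; the Lie algebra of `H` has non-trivial centre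
    (K H : Subgroup G) (hHK : H ≤ K)
    (hKclosed : IsClosed (K : Set G)) (hKconn : IsConnected (K : Set G))
    (hHclosed : IsClosed (H : Set G)) (hHconn : IsConnected (H : Set G))
    (hcentre : lieCentre (subgroupLieAlgebra (E := E) H) ≠ ⊥)
    -- the smooth structure of `G/H`: the one for which the projection is a submersion
    {F : Type*} [NormedAddCommGroup F] [NormedSpace ℝ F] [FiniteDimensional ℝ F]
    [ChartedSpace F (G ⧸ H)] [IsManifold 𝓘(ℝ, F) ∞ (G ⧸ H)]
    (hproj : IsSubmersion 𝓘(ℝ, E) 𝓘(ℝ, F) ∞ (fun p : G => (p : G ⧸ H)))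
    -- the subspaces `𝔪₁ ≅ T_o(G/K)` and `𝔪₂ ≅ T_o(K/H)`
    (𝔪₁ 𝔪₂ : Submodule ℝ (GroupLieAlgebra 𝓘(ℝ, E) G))
    (h𝔪₁ : 𝔪₁ = orthComplement (b.inner 1) (subgroupLieAlgebra K))
    (h𝔪₂ : 𝔪₂ = subgroupLieAlgebra K ⊓ orthComplement (b.inner 1) (subgroupLieAlgebra H))
    -- the `G`-invariant metric `g_λ` and its Levi-Civita connection
    (lam : ℝ) (hlam : 0 < lam)
    (g : ContMDiffRiemannianMetric 𝓘(ℝ, F) ∞ F (fun x : G ⧸ H => TangentSpace 𝓘(ℝ, F) x))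
    (hginv : IsInvariantMetric g)
    (hgo : ∀ X₁ ∈ 𝔪₁, ∀ X₂ ∈ 𝔪₂, ∀ Y₁ ∈ 𝔪₁, ∀ Y₂ ∈ 𝔪₂,
      g.inner ((1 : G) : G ⧸ H) (projDeriv H (X₁ + X₂)) (projDeriv H (Y₁ + Y₂)) =
        b.inner 1 X₁ Y₁ + lam * b.inner 1 X₂ Y₂)
    (nabla : CovariantDerivative 𝓘(ℝ, F) F (fun x : G ⧸ H => TangentSpace 𝓘(ℝ, F) x))
    (hnabla : IsLeviCivita g nabla)
    -- the `G`-invariant tensor `I^W`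
    (W : GroupLieAlgebra 𝓘(ℝ, E) G) (hW : W ∈ lieCentre (subgroupLieAlgebra H))
    (J : ∀ x : G ⧸ H, TangentSpace 𝓘(ℝ, F) x →L[ℝ] TangentSpace 𝓘(ℝ, F) x)
    (hJinv : IsInvariantTensor J)
    (hJo : ∀ X₁ ∈ 𝔪₁, ∀ X₂ ∈ 𝔪₂,
      J ((1 : G) : G ⧸ H) (projDeriv H (X₁ + X₂)) = projDeriv H (⁅W, X₁⁆ + (1 / lam) • ⁅W, X₂⁆))
    -- the constant `k`, the initial velocity and the curve
    (k : ℝ) (X₁ X₂ : GroupLieAlgebra 𝓘(ℝ, E) G) (hX₁ : X₁ ∈ 𝔪₁) (hX₂ : X₂ ∈ 𝔪₂)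
    (x : ℝ → G ⧸ H)
    (hx : ∀ t : ℝ, x t =
      ((lieExp (t • (X₁ + lam • X₂ + k • W)) *
        lieExp ((t * (1 - lam)) • (X₂ + (k / lam) • W)) : G) : G ⧸ H)) :
    -- the curve is a motion with the given initial conditions, defined for all times
    (IsChargedParticleMotionOn nabla J k x univ ∧
      (⟨x 0, velocity x 0⟩ : TangentBundle 𝓘(ℝ, F) (G ⧸ H)) =
        ⟨((1 : G) : G ⧸ H), projDeriv H (X₁ + X₂)⟩) ∧
    -- and every motion with these initial conditions coincides with it
    (∀ (y : ℝ → G ⧸ H) (S : Set ℝ), IsOpen S → IsPreconnected S → (0 : ℝ) ∈ S →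
      IsChargedParticleMotionOn nabla J k y S →
      (⟨y 0, velocity y 0⟩ : TangentBundle 𝓘(ℝ, F) (G ⧸ H)) =
        ⟨((1 : G) : G ⧸ H), projDeriv H (X₁ + X₂)⟩ →
      EqOn y x S) := by
  let a : GroupLieAlgebra 𝓘(ℝ, E) G := X₁ + lam • X₂ + k • W
  let c : GroupLieAlgebra 𝓘(ℝ, E) G := (1 - lam) • (X₂ + (k / lam) • W)
  let p : ℝ → G := fun t => lieExp (t • a) * lieExp (t • c)
  obtain ⟨S, hgS, hS₁, hS₂, hSW, hJS⟩ :=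
    exists_metric_endomorphism hproj hb hHK h𝔪₁ h𝔪₂ hlam hginv hgo hW hJinv hJo
  have hxp : ∀ t, x t = (p t : G ⧸ H) := fun t => by
    rw [hx t, mul_smul]
  have hp2 : ContMDiff 𝓘(ℝ, ℝ) 𝓘(ℝ, E) 2 p :=
    have : LieGroup 𝓘(ℝ, E) 2 G := LieGroup.of_le (n := ∞) (WithTop.coe_le_coe.2 le_top)
    (contMDiff_lieExp_smul a).mul (contMDiff_lieExp_smul c)
  have hpd : MDifferentiable 𝓘(ℝ, ℝ) 𝓘(ℝ, E) p := hp2.mdifferentiable (by norm_num)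
  have hx2 : ContMDiff 𝓘(ℝ, ℝ) 𝓘(ℝ, F) 2 x := by
    have h1 := (hproj.contMDiff.of_le (WithTop.coe_le_coe.2 le_top : (2 : WithTop ℕ∞) ≤ ∞)).comp hp2
    have h2 : x = (fun p : G => (p : G ⧸ H)) ∘ p := funext hxp
    rwa [h2]
  -- `ad (X₂ + (k / λ) W)` preserves `𝔪₁` since `X₂` and `W` belong to `𝔨`
  have hm : ∀ Z ∈ (𝔪₁ : Submodule ℝ E), lieBr (E := E) G (X₂ + (k / lam) • W) Z ∈ 𝔪₁ := by
    intro Z hZ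
    rw [h𝔪₁] at hZ ⊢
    rw [h𝔪₂] at hX₂
    exact hb.lieBr_mem_orthComplement (fun Y hY => lieBr_mem_subgroupLieAlgebra
      (Submodule.add_mem _ hX₂.1 (Submodule.smul_mem _ _
        (subgroupLieAlgebra_mono hHK hW.1))) hY) hZ
  have hmom := momentum_lieExp_mul_lieExp (S := S) (𝔪₁ := 𝔪₁) (X₁ := X₁) (X₂ := X₂) (W := W)
    (k := k) hlam.ne' hS₁ (hS₂ X₂ hX₂) hSW hm hX₁ (a := a) (c := c) rfl rfl
  have hmotion : ∀ t, covDerivAlong nabla x (velocity x) t = k • J (x t) (velocity x t) :=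
    covDerivAlong_eq_of_momentum_eq hproj hb hginv hnabla hgS hJS hx2 hpd hxp hmom
  have hx0 : x 0 = ((1 : G) : G ⧸ H) := by
    rw [hxp]; simp [p, lieExp_zero]
  have hv0 : (velocity x 0 : F) = projDeriv H (X₁ + X₂) := by
    have h1 : modelDeriv 𝓘(ℝ, ℝ) 𝓘(ℝ, F) x 0 1 = leftProj E F H (p 0) (bodyVelocity p 0) := by
      rw [← modelDeriv_proj_curve hproj (hpd 0), ← funext hxp]
    have h2 : p 0 = 1 := by simp [p, lieExp_zero]
    have h3 : bodyVelocity (E := E) p 0 = (a + c : GroupLieAlgebra 𝓘(ℝ, E) G) := by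
      refine (bodyVelocity_lieExp_mul_lieExp a c rfl rfl 0).trans ?_
      rw [zero_smul, lieExp_zero, inv_one, lieAd_one]
      rfl
    have h4 : a + c = X₁ + X₂ + (k / lam) • W := by
      have h5 : (1 - lam) * (k / lam) = k / lam - k := by
        have := hlam.ne'
        field_simp
      simp only [a, c, smul_add, smul_smul, h5, sub_smul, one_smul]
      abel
    have h5 : projDeriv (F := F) H W = 0 := projDeriv_eq_zero hproj hW.1
    rw [h2, h3, h4] at h1
    refine h1.trans ((leftProj_one hproj _).trans ?_)
    rw [map_add, map_smul, h5, smul_zero, add_zero]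
  refine ⟨⟨⟨hx2.contMDiffOn, fun t _ => hmotion t⟩, ?_⟩, ?_⟩
  · exact (tangentBundle_mk_congr (E := F) hx0 _).trans (congrArg _ hv0)
  intro y S' hS' hS'c h0 hy hy0
  have : IsClosed (H : Set G) := hHclosed
  have : IsTopologicalGroup G := topologicalGroup_of_lieGroup 𝓘(ℝ, E) ∞
  have hxe : ∀ t, ∀ᶠ s in 𝓝 t, ContMDiffAt 𝓘(ℝ, ℝ) 𝓘(ℝ, F) 2 x s ∧
      covDerivAlong nabla x (velocity x) s = k • J (x s) (velocity x s) := fun t =>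
    Filter.Eventually.of_forall fun s => ⟨hx2.contMDiffAt, hmotion s⟩
  have hye : ∀ t ∈ S', ∀ᶠ s in 𝓝 t, ContMDiffAt 𝓘(ℝ, ℝ) 𝓘(ℝ, F) 2 y s ∧
      covDerivAlong nabla y (velocity y) s = k • J (y s) (velocity y s) := fun t ht => by
    filter_upwards [hS'.mem_nhds ht] with s hs
    exact ⟨hy.1.contMDiffAt (hS'.mem_nhds hs), hy.2 s hs⟩
  have hloc : ∀ t ∈ S', y t = x t →
      modelDeriv 𝓘(ℝ, ℝ) 𝓘(ℝ, F) y t 1 = modelDeriv 𝓘(ℝ, ℝ) 𝓘(ℝ, F) x t 1 → y =ᶠ[𝓝 t] x :=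
    fun t ht h1 h2 => eventuallyEq_of_motion hproj hb hginv hnabla hgS hJS (hye t ht) (hxe t) h1 h2
  have hsub : S' ⊆ {t | y =ᶠ[𝓝 t] x} := by
    -- the times of local agreement form an open set which is closed in the interval
    refine hS'c.subset_of_closure_inter_subset isOpen_setOfPred_eventually_nhds ⟨0, h0, ?_⟩ ?_
    · obtain ⟨h1, h2⟩ := tangentBundle_mk_inj hy0
      exact hloc 0 h0 (h1.trans hx0.symm) (h2.trans hv0.symm)
    · rintro t ⟨ht, htS⟩
      obtain ⟨h1, h2⟩ := eq_and_modelDeriv_eq_of_frequently hx2.contMDiffAt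
        (hye t htS).self_of_nhds.1 (mem_closure_iff_frequently.1 ht)
      exact hloc t htS h1 h2
  exact fun t ht => (hsub ht).self_of_nhds
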